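/- **Setting.** Let $n,k\ge 1$ with $k\mid n$. The graph $G_{n,k}$ consists of $n/k$ cliques $C_1,\dots,C_{n/k}$ of size $k$, consecutive cliques being joined by a perfect matching (nodes $(i,j)$ with $i\le n/k$, $j\le k$; $(i,j)\sim(i,j')$ for $j\ne j'$, and $(i,j)\sim(i\pm1,j)$). Each node $u$ holds a message $m_u$. In each synchronous round every node sends one message to all its neighbours (no failures). Node $u$ maintains the set $R_u$ of known messages (initially $\{m_u\}$), the set $S_u$ of sent messages (initially $\emptyset$), the number $cnt_{u,v}$ of receptions of $m_v$ (initially $1$ if $v=u$, else $0$), and $B_u=R_u\setminus S_u$. Information spreading is complete when every $R_u$ contains all $n$ messages. **Parameters.** Logarithms are to base $2$. For constants $\alpha,d>0$ and $0<\hat c\le\frac12$ put $\tau=\lceil\alpha\log n\rceil$, $\tau'=\lceil 8d\tau\log^2 n\rceil$, $T=\tau/2$. A message $m_v\in R_u$ is *fresh* for $u$ if $cnt_{u,v}<T$. **Algorithm 2.** All random choices of distinct nodes are independent. The phases are: round 0, in which every $u$ sends $m_u$; one random phase of $\tau$ rounds; then, forever, alternately a ranking phase of $\tau'$ rounds and a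 shuffle phase of $8\tau$ rounds. In round 0 and in the random and ranking phases, a message sent by $u$ is added to $S_u$, and each received message $m_v$ is added to $R_u$ with $cnt_{u,v}$ increased by one per reception. A node whose set $\hat B_u$ (below) is empty sends its own message. - *Random phase.* At the start $\hat B_u:=B_u$; in each round $u$ removes a uniformly random message from $\hat B_u$ and sends it. - *Ranking phase.* At the start $\hat B_u:=B_u$, except that after a shuffle phase the messages of $B_u$ that have $cnt_{u,v}<T$ and were not selected at the end of that shuffle phase are left out. The $b$ messages of $\hat B_u$ are sorted into a list: first those selected at the end of the preceding shuffle phase (if any), in arbitrary order, then the others by increasing $cnt$, ties broken arbitrarily. The message at position $r$ gets probability $\frac1{rH_b}$, $H_b=\sum_{i=1}^b\frac1i$. In each round $u$ draws a message from $\hat B_u$ according to these probabilities, renormalized over the messages still in $\hat B_u$, removes it from $\hat B_u$ and sends it. - *Shuffle phase.* At the start $\hat B_u$ is the set of fresh messages in $B_u$. In each round $u$ removes an arbitrary message from $\hat B_u$ and sends it. The variables $R_u,S_u,cnt$ do not change during the phase; instead $phasecnt_{u,v}$ counts the receptions of $m_v$ in the phase, starting from $1$ if $m_v$ was in $\hat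 B_u$ at the start and from $0$ otherwise. At the end, $R$ is the set of messages with $phasecnt_{u,v}\ge 1$, $phasecnt_{u,v}\ge\hat c\,T$ and $cnt_{u,v}<T$. Then $R$ is added to $R_u$, and $u$ selects $\min(4\tau,|R|)$ messages of $R$ uniformly at random. The arbitrary choices are made by any fixed rule that may depend on the node, the round and the node's local state. **Theorem.** Let $c\ge1$, $\alpha>48c+96$ and $d>c+3$. There is a constant $C=C(c,\alpha,d)>0$ such that for every $\hat c\in(0,\frac12]$ and every $k=k(n)$ with $k=\omega(\log^3 n)$ the following holds for all sufficiently large $n$ with $k\mid n$: for every rule for the arbitrary choices, Algorithm 2, run without failures on $G_{n,k}$, completes information spreading within $C\,\frac{n\log^3 n}{k}$ rounds with probability at least $1-\frac1{n^c}$. -/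

import Mathlib

open Filter
open scoped ENNReal NNReal

noncomputable section

namespace InfoSpreading

/-- The graph `G_{n,k}`: a path of `n / k` cliques `C_1, …, C_{n/k}`, each of size `k`, consecutive
cliques being joined by a perfect matching.  The node `(i, j)` is the node of the `i`-th clique that
lies on the `j`-th layer. -/
def cliquePath (n k : ℕ) : SimpleGraph (Fin (n / k) × Fin k) :=
  SimpleGraph.boxProd (SimpleGraph.pathGraph (n / k)) (⊤ : SimpleGraph (Fin k))

/-! ### Parameters and the schedule of rounds -/

/-- Numerical parameters of the algorithm: the length `tau` of the random phase, the length
`tauRank` of a ranking phase, and the constant `cHat` of the filter of a shuffle phase. -/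
structure Params where
  tau : ℕ
  tauRank : ℕ
  cHat : ℝ

/-- `τ = α log n` and `τ' = 8 d τ log² n`, rounded up; logarithms are to base two. -/
def params (α d cHat : ℝ) (n : ℕ) : Params where
  tau := ⌈α * Real.logb 2 n⌉₊
  tauRank := ⌈8 * d * (⌈α * Real.logb 2 n⌉₊ : ℝ) * Real.logb 2 n ^ 2⌉₊
  cHat := cHat

/-- The freshness threshold `T = τ / 2`. -/
def Params.threshold (p : Params) : ℝ := (p.tau : ℝ) / 2

/-- The part of the algorithm a round belongs to; the number is the index, from `0`, of the round
within its phase. -/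
inductive Stage where
  | initial : Stage
  | random (i : ℕ) : Stage
  | ranking (i : ℕ) : Stage
  | shuffle (i : ℕ) : Stage

/-- Round `0`, then `τ` rounds of the random phase, and then, for ever, `τ'` rounds of a ranking
phase followed by `8 τ` rounds of a shuffle phase. -/
def Params.stage (p : Params) (t : ℕ) : Stage :=
  if t = 0 then .initial
  else if t ≤ p.tau then .random (t - 1)
  else
    let i := (t - 1 - p.tau) % (p.tauRank + 8 * p.tau)
    if i < p.tauRank then .ranking i else .shuffle (i - p.tauRank)

/-! ### The local state of a node

The message `m_v` is identified with the node `v` at which it originates. -/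

/-- The variables held by a node `u`. -/
structure NodeState (V : Type*) where
  /-- `R_u`, the messages known to `u`. -/
  received : Finset V
  /-- `S_u`, the messages already sent by `u`. -/
  sent : Finset V
  /-- `cnt_{u,v}`, the number of receptions of `m_v`. -/
  cnt : V → ℕ
  /-- The set `B̂_u` of the messages that may still be sent in the current phase. -/
  buffer : Finset V
  /-- `Prob`, the probability space computed at the start of a random or ranking phase. -/
  prob : V → ℝ≥0
  /-- `phasecnt_{u,v}`, the counters of the current shuffle phase. -/
  phasecnt : V → ℕ
  /-- The messages selected at the end of the last shuffle phase (none before the first one). -/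
  selected : Finset V
  /-- The messages below the freshness threshold that were not selected at the end of the last
  shuffle phase: the node takes no responsibility for them in the next ranking phase. -/
  deferred : Finset V

section Algorithm

variable {V : Type*} [Fintype V] [DecidableEq V]

/-- The state of node `u` before round `0`. -/
def NodeState.init (u : V) : NodeState V where
  received := {u}
  sent := ∅
  cnt := fun v => if v = u then 1 else 0
  buffer := ∅
  prob := fun _ => 0
  phasecnt := fun _ => 0
  selected := ∅
  deferred := ∅

/-- `B_u = R_u - S_u`. -/
def NodeState.unsent (s : NodeState V) : Finset V := s.received \ s.sent

open Classical in
/-- The known messages `m_v` with `cnt_{u,v} < T`. -/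
def NodeState.fresh (p : Params) (s : NodeState V) : Finset V :=
  s.received.filter fun v => (s.cnt v : ℝ) < p.threshold

/-- The sorting key of the ranking function: the messages selected in the last shuffle phase come
first, the other ones follow by increasing `cnt`; ties are broken by `tie`. -/
def NodeState.sortKey (s : NodeState V) (tie : V ↪ ℕ) (v : V) : ℕ ×ₗ ℕ ×ₗ ℕ :=
  if v ∈ s.selected then toLex (0, toLex (0, tie v)) else toLex (1, toLex (s.cnt v, tie v))

open Classical in
/-- The position, from `1`, of the message `m_v` in the sorted list of the messages of `B`. -/
def NodeState.rank (s : NodeState V) (tie : V ↪ ℕ) (B : Finset V) (v : V) : ℕ :=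
  (B.filter fun w => s.sortKey tie w ≤ s.sortKey tie v).card

/-- The ranking function: a message of rank `r` in a list of `b` messages has
probability `1 / (r H_b)`. -/
def NodeState.rankingFunction (s : NodeState V) (tie : V ↪ ℕ) (B : Finset V) (v : V) : ℝ≥0 :=
  1 / ((s.rank tie B v : ℝ≥0) * ∑ j ∈ Finset.range B.card, 1 / ((j : ℝ≥0) + 1))

/-- What a node does at the start of a round, before sending: it assigns `B̂` and `Prob` at the
start of a random or ranking phase, and `B̂` and `phasecnt` at the start of a shuffle phase. -/
def NodeState.prepare (p : Params) (tie : V ↪ ℕ) (s : NodeState V) : Stage → NodeState V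
  | .random 0 =>
      { s with
        buffer := s.unsent
        prob := fun _ => 1 / (s.unsent.card : ℝ≥0) }
  | .ranking 0 =>
      { s with
        buffer := s.unsent \ s.deferred
        prob := s.rankingFunction tie (s.unsent \ s.deferred) }
  | .shuffle 0 =>
      { s with
        buffer := s.fresh p ∩ s.unsent
        phasecnt := fun v => if v ∈ s.fresh p ∩ s.unsent then 1 else 0 }
  | _ => s

/-- The unnormalized law by which a message is drawn from `B̂`: messages already popped have left
`B̂`, which nullifies their probability. -/
def NodeState.weight (s : NodeState V) (v : V) : ℝ≥0∞ :=
  if v ∈ s.buffer then (s.prob v : ℝ≥0∞) else 0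

theorem NodeState.tsum_weight_ne_top (s : NodeState V) : (∑' v, s.weight v) ≠ ∞ := by
  rw [tsum_fintype]
  refine ENNReal.sum_ne_top.2 fun v _ => ?_
  unfold NodeState.weight
  split_ifs
  · exact ENNReal.coe_ne_top
  · exact ENNReal.zero_ne_top

open Classical in
/-- The law of the message popped from `B̂` according to `Prob`, renormalized over the messages
that remain in `B̂`; a node with nothing left to pop sends its own message. -/
def NodeState.popLaw (u : V) (s : NodeState V) : PMF V :=
  if h : (∑' v, s.weight v) ≠ 0 then PMF.normalize s.weight h s.tsum_weight_ne_top
  else PMF.pure u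

open Classical in
/-- The message sent in a round of a shuffle phase: some message of `B̂` (which one is decided by
`tie`), and the own message when `B̂` is empty. -/
def NodeState.shuffleMessage (u : V) (tie : V ↪ ℕ) (s : NodeState V) : V :=
  if h : s.buffer.Nonempty then (s.buffer.exists_min_image tie h).choose else u

/-- The law of the message that node `u` sends. -/
def NodeState.messageLaw (u : V) (tie : V ↪ ℕ) (s : NodeState V) : Stage → PMF V
  | .initial => PMF.pure u
  | .random _ => s.popLaw u
  | .ranking _ => s.popLaw u
  | .shuffle _ => PMF.pure (s.shuffleMessage u tie)

open Classical in
/-- The number of times node `u` receives `m_v` in a round in which every node `w` sends the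
message `m_{c w}` to all of its neighbours. -/
def receptions (G : SimpleGraph V) (c : V → V) (u v : V) : ℕ :=
  (Finset.univ.filter fun w => G.Adj u w ∧ c w = v).card

/-- The update of the variables of node `u` in a round in which every node `w` sends `m_{c w}`.
In a shuffle phase only `B̂` and `phasecnt` change. -/
def NodeState.deliver (G : SimpleGraph V) (c : V → V) (u : V) (s : NodeState V) :
    Stage → NodeState V
  | .shuffle _ =>
      { s with
        buffer := s.buffer.erase (c u)
        phasecnt := fun v => s.phasecnt v + receptions G c u v }
  | _ =>
      { s with
        buffer := s.buffer.erase (c u)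
        sent := insert (c u) s.sent
        received := s.received ∪ Finset.univ.filter fun v => 0 < receptions G c u v
        cnt := fun v => s.cnt v + receptions G c u v }

open Classical in
/-- The set `R` at the end of a shuffle phase, after filtering: of the messages seen during the
phase, those with `phasecnt ≥ ĉ T` that were not non-fresh when the phase started (the counters
`cnt` do not change during a shuffle phase). -/
def NodeState.candidates (p : Params) (s : NodeState V) : Finset V :=
  Finset.univ.filter fun v =>
    0 < s.phasecnt v ∧ p.cHat * p.threshold ≤ (s.phasecnt v : ℝ) ∧ (s.cnt v : ℝ) < p.threshold

/-- A uniformly random set of `4 τ` messages of `R` (all of `R`, if it has fewer). -/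
def NodeState.selectionLaw (p : Params) (s : NodeState V) : PMF (Finset V) :=
  PMF.uniformOfFinset
    (Finset.powersetCard (min (4 * p.tau) (s.candidates p).card) (s.candidates p))
    (Finset.powersetCard_nonempty.2 (min_le_right _ _))

/-- The end of a shuffle phase: `R` is added to `R_u`, and the set `A` is selected. -/
def NodeState.finishShuffle (p : Params) (s : NodeState V) (A : Finset V) : NodeState V :=
  let s' : NodeState V := { s with received := s.received ∪ s.candidates p }
  { s' with selected := A, deferred := s'.fresh p \ A }

/-! ### The execution -/

/-- Independent choices of all nodes, node `u` choosing by the law `P u`. -/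
def independent {β : Type*} [Fintype β] (P : V → PMF β) : PMF (V → β) :=
  PMF.ofFintype (fun c => ∏ u, P u (c u)) (by
    classical
    rw [← Fintype.prod_sum fun u b => P u b]
    refine Finset.prod_eq_one fun u _ => ?_
    rw [← tsum_fintype (L := .unconditional _)]
    exact (P u).tsum_coe)

/-- A rule for the choices that the algorithm leaves arbitrary (the breaking of ties in the sorted
lists, the order of the selected messages, the order of sending in shuffle phases): for every node,
round and local state, a priority order of the messages. -/
abbrev TieRule (V : Type*) := V → ℕ → NodeState V → (V ↪ ℕ)

/-- Round `t` of the algorithm. -/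
def step (p : Params) (G : SimpleGraph V) (tie : TieRule V) (t : ℕ) (σ : V → NodeState V) :
    PMF (V → NodeState V) :=
  let ready : V → NodeState V := fun u => (σ u).prepare p (tie u t (σ u)) (p.stage t)
  (independent fun u => (ready u).messageLaw u (tie u t (ready u)) (p.stage t)).bind fun c =>
    let next : V → NodeState V := fun u => (ready u).deliver G c u (p.stage t)
    match p.stage t with
    | .shuffle i =>
        if i + 1 = 8 * p.tau then
          (independent fun u => (next u).selectionLaw p).map
            fun A u => (next u).finishShuffle p (A u)
        else PMF.pure next
    | _ => PMF.pure next

/-- The law of the global state after the first `t` rounds (the rounds `0, …, t - 1`). -/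
def execution (p : Params) (G : SimpleGraph V) (tie : TieRule V) : ℕ → PMF (V → NodeState V)
  | 0 => PMF.pure NodeState.init
  | t + 1 => (execution p G tie t).bind (step p G tie t)

/-- Information spreading is complete: every node knows every message. -/
def Complete (σ : V → NodeState V) : Prop := ∀ u v : V, v ∈ (σ u).received

/-- The probability that information spreading is complete after the first `t` rounds. -/
def probComplete (p : Params) (G : SimpleGraph V) (tie : TieRule V) (t : ℕ) : ℝ≥0∞ :=
  (execution p G tie t).toOuterMeasure {σ | Complete σ}

end Algorithm

end InfoSpreading

end

/-! Information advances like a wave, by one clique per ranking and shuffle phase. The invariant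
`RankingStart p r` says that every node knows the messages from distance at most `r` and has
received each at least `T` times, and that each message from distance exactly `r + 1` is held,
unsent and with rank at most `8τ`, by slightly more than `τ/2` nodes of the clique.

In a ranking phase such a holder draws the message with probability at least `1/(8τ H_n)` in each
round, so within `τ'` rounds it sends it except with polynomially small probability. The whole
clique then hears it `T` times, and every holder also passes it along its matching edges. In the
next clique it is still fresh: a message at distance at least `r + 2` has only been sent by nodes on
its own layer, so a node hears it at most three times. This is `ShuffleStart p r`, obtained in
`RankingStart.shuffleStart`.

In the shuffle phase every node has at most `8τ` fresh unsent messages, hence sends them all. It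
counts more than `τ/2` copies of each message at distance `r + 2`, but at most four of a farther
one, so the filter `ĉT > 4` leaves exactly the messages at distance `r + 2`
(`ShuffleStart.candidates_eq`). All nodes of a clique thus agree on a candidate set of size between
`k` and `2k`, and independent selections of `4τ` candidates give every message at least `2τ`
responsible nodes per clique on average, and more than `τ/2` with high probability. Selected
messages head the lists, which restores the invariant (`ShuffleStart.rankingStart`). The random
phase starts the wave, since each message is sent by about `τ` nodes of its own clique
(`rankingStart_zero`).

These implications are deterministic. The probability enters through `expect_mem_buffer_popRun_le`
for the ranking phases and through exponential moments, which factor over the nodes, for the random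
phase and the selections (`expect_prod_popRun`, `expect_selectionLaw_mem`). A union bound over pairs
of nodes and over at most `n/k` phases finishes the proof. -/

noncomputable section

namespace InfoSpreading

/-! ### Expectations with respect to a probability mass function -/

/-- The expectation of a nonnegative function. -/
def expect {β : Type*} (μ : PMF β) (f : β → ℝ≥0∞) : ℝ≥0∞ := ∑' a, μ a * f a

section Expect

variable {β γ : Type*}

theorem expect_pure (a : β) (f : β → ℝ≥0∞) : expect (PMF.pure a) f = f a := by
  classical
  unfold expect
  rw [tsum_eq_single a]
  · simp
  · intro b hb
    simp [hb]

theorem expect_bind (μ : PMF β) (κ : β → PMF γ) (f : γ → ℝ≥0∞) :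
    expect (μ.bind κ) f = expect μ fun a => expect (κ a) f := by
  unfold expect
  simp_rw [PMF.bind_apply, ← ENNReal.tsum_mul_right, ← ENNReal.tsum_mul_left]
  rw [ENNReal.tsum_comm]
  simp_rw [mul_assoc]

theorem expect_map (μ : PMF β) (g : β → γ) (f : γ → ℝ≥0∞) :
    expect (μ.map g) f = expect μ (f ∘ g) := by
  rw [← PMF.bind_pure_comp, expect_bind]
  simp [expect_pure, Function.comp_def]

theorem expect_mono {μ : PMF β} {f g : β → ℝ≥0∞} (h : ∀ a ∈ μ.support, f a ≤ g a) :
    expect μ f ≤ expect μ g := by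
  refine ENNReal.tsum_le_tsum fun a => ?_
  by_cases ha : a ∈ μ.support
  · exact mul_le_mul_right (h a ha) _
  · simp [(PMF.apply_eq_zero_iff μ a).2 ha]

theorem expect_const (μ : PMF β) (x : ℝ≥0∞) : expect μ (fun _ => x) = x := by
  unfold expect
  rw [ENNReal.tsum_mul_right, μ.tsum_coe, one_mul]

theorem expect_add (μ : PMF β) (f g : β → ℝ≥0∞) :
    expect μ (fun a => f a + g a) = expect μ f + expect μ g := by
  unfold expect
  simp_rw [mul_add]
  exact ENNReal.tsum_add

theorem expect_const_mul (μ : PMF β) (x : ℝ≥0∞) (f : β → ℝ≥0∞) :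
    expect μ (fun a => x * f a) = x * expect μ f := by
  unfold expect
  rw [← ENNReal.tsum_mul_left]
  exact tsum_congr fun a => by ring

theorem expect_mul_const (μ : PMF β) (f : β → ℝ≥0∞) (x : ℝ≥0∞) :
    expect μ (fun a => f a * x) = expect μ f * x := by
  simp_rw [mul_comm _ x]
  exact expect_const_mul μ x f

theorem expect_sum {ι : Type*} (s : Finset ι) (μ : PMF β) (f : ι → β → ℝ≥0∞) :
    expect μ (fun a => ∑ i ∈ s, f i a) = ∑ i ∈ s, expect μ (f i) := by
  classical
  induction s using Finset.induction_on with
  | empty => simpa using expect_const μ 0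
  | insert i s hi ih => simp_rw [Finset.sum_insert hi, expect_add, ih]

open Classical in
/-- The probability that `Q` fails. -/
def failProb (μ : PMF β) (Q : β → Prop) : ℝ≥0∞ := expect μ fun a => if Q a then 0 else 1

theorem failProb_mono {μ : PMF β} {Q R : β → Prop} (h : ∀ a ∈ μ.support, Q a → R a) :
    failProb μ R ≤ failProb μ Q := by
  refine expect_mono fun a ha => ?_
  by_cases hq : Q a
  · simp [hq, h a ha hq]
  · rw [if_neg hq]
    split_ifs <;> simp

/-- Either the first stage misses `Q`, or the second fails from a state satisfying `Q`. This chains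
the phases without conditioning: each one is analysed from an arbitrary good state. -/
theorem failProb_bind_le {μ : PMF β} {κ : β → PMF γ} {Q : β → Prop} {R : γ → Prop} {ε : ℝ≥0∞}
    (h : ∀ a ∈ μ.support, Q a → failProb (κ a) R ≤ ε) :
    failProb (μ.bind κ) R ≤ failProb μ Q + ε := by
  have hle : ∀ ν : PMF γ, failProb ν R ≤ 1 := fun ν => by
    refine (expect_mono (g := fun _ => 1) fun a _ => ?_).trans (expect_const ν 1).le
    split_ifs <;> simp
  unfold failProb
  rw [expect_bind, ← expect_const μ ε, ← expect_add]
  refine expect_mono fun a ha => ?_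
  by_cases hq : Q a
  · rw [if_pos hq, zero_add]
    exact h a ha hq
  · rw [if_neg hq]
    exact (hle _).trans le_self_add

/-- Markov's inequality, to be applied to exponential moments and to indicators. -/
theorem failProb_le_expect {μ : PMF β} {Q : β → Prop} {f : β → ℝ≥0∞}
    (h : ∀ a ∈ μ.support, ¬ Q a → 1 ≤ f a) : failProb μ Q ≤ expect μ f := by
  refine expect_mono fun a ha => ?_
  split_ifs with hq
  · exact zero_le
  · exact h a ha hq

theorem failProb_and_le (μ : PMF β) (Q R : β → Prop) :
    failProb μ (fun a => Q a ∧ R a) ≤ failProb μ Q + failProb μ R := by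
  unfold failProb
  rw [← expect_add]
  refine expect_mono fun a _ => ?_
  by_cases hq : Q a <;> by_cases hr : R a <;> simp [hq, hr]

theorem failProb_forall_le {ι : Type*} [Fintype ι] (μ : PMF β) (Q : ι → β → Prop) (ε : ℝ≥0∞)
    (h : ∀ i, failProb μ (Q i) ≤ ε) :
    failProb μ (fun a => ∀ i, Q i a) ≤ Fintype.card ι * ε := by
  classical
  have h1 : failProb μ (fun a => ∀ i, Q i a) ≤ ∑ i, failProb μ (Q i) := by
    unfold failProb
    rw [← expect_sum]
    refine expect_mono fun a _ => ?_
    split_ifs with hq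
    · exact zero_le
    · push Not at hq
      obtain ⟨i, hi⟩ := hq
      refine le_trans ?_ (Finset.single_le_sum (f := fun i => if Q i a then (0 : ℝ≥0∞) else 1)
        (fun _ _ => zero_le) (Finset.mem_univ i))
      simp [hi]
  refine h1.trans ((Finset.sum_le_sum fun i _ => h i).trans ?_)
  simp

theorem failProb_forall_pair_le {ι : Type*} [Fintype ι] (μ : PMF β) (Q : ι → ι → β → Prop)
    (ε : ℝ≥0∞) (h : ∀ i j, failProb μ (Q i j) ≤ ε) :
    failProb μ (fun a => ∀ i j, Q i j a) ≤ (Fintype.card ι : ℝ≥0∞) ^ 2 * ε := by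
  refine (failProb_mono fun a _ ha i j => ha (i, j)).trans
    ((failProb_forall_le μ (fun x : ι × ι => Q x.1 x.2) ε fun x => h x.1 x.2).trans_eq ?_)
  rw [Fintype.card_prod]
  push_cast
  ring

theorem failProb_eq_zero {μ : PMF β} {Q : β → Prop} (h : ∀ a, Q a) : failProb μ Q = 0 := by
  unfold failProb
  simp [h, expect_const]

theorem one_sub_le_toOuterMeasure (μ : PMF β) (Q : β → Prop) :
    1 - failProb μ Q ≤ μ.toOuterMeasure {a | Q a} := by
  classical
  rw [tsub_le_iff_right, PMF.toOuterMeasure_apply]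
  unfold failProb expect
  rw [← ENNReal.tsum_add, ← μ.tsum_coe]
  refine ENNReal.tsum_le_tsum fun a => ?_
  by_cases hq : Q a <;> simp [hq]

end Expect

/-! ### Independent choices of the nodes. -/

section Independent

variable {V β : Type*} [Fintype V] [DecidableEq V] [Fintype β]

theorem expect_independent_prod (P : V → PMF β) (f : V → β → ℝ≥0∞) :
    expect (independent P) (fun c => ∏ u, f u (c u)) = ∏ u, expect (P u) (f u) := by
  classical
  unfold expect
  simp_rw [tsum_fintype]
  rw [Fintype.prod_sum]
  refine Finset.sum_congr rfl fun c _ => ?_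
  rw [Finset.prod_mul_distrib]
  rfl

theorem expect_independent_prod_mem (P : V → PMF β) (W : Finset V) (f : V → β → ℝ≥0∞) :
    expect (independent P) (fun c => ∏ u ∈ W, f u (c u)) = ∏ u ∈ W, expect (P u) (f u) := by
  have h := expect_independent_prod P fun u b => if u ∈ W then f u b else 1
  simp only [Finset.prod_ite_mem, Finset.univ_inter] at h
  rw [h, ← Finset.prod_subset (Finset.subset_univ W)
    (fun u _ hu => by simp only [if_neg hu]; exact expect_const _ 1)]
  exact Finset.prod_congr rfl fun u hu => by simp only [if_pos hu]

theorem expect_independent_apply (P : V → PMF β) (u : V) (f : β → ℝ≥0∞) :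
    expect (independent P) (fun c => f (c u)) = expect (P u) f := by
  simpa using expect_independent_prod_mem P {u} fun _ => f

theorem mem_support_of_independent {P : V → PMF β} {c : V → β}
    (hc : c ∈ (independent P).support) (u : V) : c u ∈ (P u).support := by
  rw [PMF.mem_support_iff] at hc ⊢
  intro h0
  exact hc (Finset.prod_eq_zero (Finset.mem_univ u) h0)

end Independent

/-! ### Rounds in which messages are popped -/

section Pop

variable {V : Type*} [Fintype V] [DecidableEq V]

/-- A round of a random or ranking phase, after the preparation of the nodes. -/
def popStep (G : SimpleGraph V) (σ : V → NodeState V) : PMF (V → NodeState V) :=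
  (independent fun u => (σ u).popLaw u).map fun c u => (σ u).deliver G c u .initial

/-- `L` rounds of a random or ranking phase, after the preparation of the nodes. -/
def popRun (G : SimpleGraph V) : ℕ → (V → NodeState V) → PMF (V → NodeState V)
  | 0, σ => PMF.pure σ
  | L + 1, σ => (popStep G σ).bind (popRun G L)

/-- The `m` rounds that follow the rounds `0, …, t - 1`, from a given global state. -/
def run (p : Params) (G : SimpleGraph V) (tie : TieRule V) :
    ℕ → ℕ → (V → NodeState V) → PMF (V → NodeState V)
  | _, 0, σ => PMF.pure σ
  | t, m + 1, σ => (step p G tie t σ).bind (run p G tie (t + 1) m)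

theorem execution_add (p : Params) (G : SimpleGraph V) (tie : TieRule V) (t m : ℕ) :
    execution p G tie (t + m) = (execution p G tie t).bind (run p G tie t m) := by
  induction m generalizing t with
  | zero => simp [run, PMF.bind_pure]
  | succ m ih =>
    rw [← Nat.succ_add_eq_add_succ, ih]
    simp [execution, run, PMF.bind_bind]

/-- `popStep` may deliver with stage `.initial` because `deliver` only distinguishes shuffle rounds
from all others. -/
theorem step_of_random {p : Params} {G : SimpleGraph V} {tie : TieRule V} {t i : ℕ}
    (h : p.stage t = .random i) (σ : V → NodeState V) :
    step p G tie t σ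
      = popStep G fun u => (σ u).prepare p (tie u t (σ u)) (.random i) := by
  unfold step popStep
  rw [h]
  simp only [NodeState.messageLaw]
  rw [← PMF.bind_pure_comp]
  rfl

theorem step_of_ranking {p : Params} {G : SimpleGraph V} {tie : TieRule V} {t i : ℕ}
    (h : p.stage t = .ranking i) (σ : V → NodeState V) :
    step p G tie t σ
      = popStep G fun u => (σ u).prepare p (tie u t (σ u)) (.ranking i) := by
  unfold step popStep
  rw [h]
  simp only [NodeState.messageLaw]
  rw [← PMF.bind_pure_comp]
  rfl

theorem run_of_random {p : Params} {G : SimpleGraph V} {tie : TieRule V} {t i m : ℕ}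
    (h : ∀ j < m, p.stage (t + j) = .random (i + 1 + j)) (σ : V → NodeState V) :
    run p G tie t m σ = popRun G m σ := by
  induction m generalizing t i σ with
  | zero => rfl
  | succ m ih =>
    have h0 := h 0 (by omega)
    simp only [add_zero] at h0
    simp only [run, popRun, step_of_random h0]
    congr 1
    funext τ
    exact ih (i := i + 1) (fun j hj => by
      rw [show t + 1 + j = t + (j + 1) by ring, h (j + 1) (by omega)]
      congr 1
      ring) τ

theorem run_of_ranking {p : Params} {G : SimpleGraph V} {tie : TieRule V} {t i m : ℕ}
    (h : ∀ j < m, p.stage (t + j) = .ranking (i + 1 + j)) (σ : V → NodeState V) :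
    run p G tie t m σ = popRun G m σ := by
  induction m generalizing t i σ with
  | zero => rfl
  | succ m ih =>
    have h0 := h 0 (by omega)
    simp only [add_zero] at h0
    simp only [run, popRun, step_of_ranking h0]
    congr 1
    funext τ
    exact ih (i := i + 1) (fun j hj => by
      rw [show t + 1 + j = t + (j + 1) by ring, h (j + 1) (by omega)]
      congr 1
      ring) τ

theorem run_random_phase {p : Params} {G : SimpleGraph V} {tie : TieRule V} {t m : ℕ} (hm : 0 < m)
    (h : ∀ j < m, p.stage (t + j) = .random j) (σ : V → NodeState V) :
    run p G tie t m σ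
      = popRun G m fun u => (σ u).prepare p (tie u t (σ u)) (.random 0) := by
  obtain ⟨m, rfl⟩ : ∃ l, m = l + 1 := ⟨m - 1, by omega⟩
  have h0 := h 0 hm
  simp only [add_zero] at h0
  simp only [run, popRun, step_of_random h0]
  congr 1
  funext τ
  exact run_of_random (i := 0) (fun j hj => by
    rw [add_assoc, h (1 + j) (by omega), zero_add]) τ

theorem run_ranking_phase {p : Params} {G : SimpleGraph V} {tie : TieRule V} {t m : ℕ} (hm : 0 < m)
    (h : ∀ j < m, p.stage (t + j) = .ranking j) (σ : V → NodeState V) :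
    run p G tie t m σ
      = popRun G m fun u => (σ u).prepare p (tie u t (σ u)) (.ranking 0) := by
  obtain ⟨m, rfl⟩ : ∃ l, m = l + 1 := ⟨m - 1, by omega⟩
  have h0 := h 0 hm
  simp only [add_zero] at h0
  simp only [run, popRun, step_of_ranking h0]
  congr 1
  funext τ
  exact run_of_ranking (i := 0) (fun j hj => by
    rw [add_assoc, h (1 + j) (by omega), zero_add]) τ

/-- The second alternative is the default of a node with nothing to pop. It is the source of all
exceptions for own messages in `PopRel`. -/
theorem mem_support_popLaw {u v : V} {s : NodeState V} (h : v ∈ (s.popLaw u).support) :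
    v ∈ s.buffer ∨ v = u := by
  unfold NodeState.popLaw at h
  split_ifs at h with h0
  · rw [PMF.mem_support_normalize_iff] at h
    by_contra! hv
    simp [NodeState.weight, hv.1] at h
  · right
    simpa using h

open Classical in
/-- The pathwise relation of the global states before and after some rounds of a random or
ranking phase. -/
structure PopRel (G : SimpleGraph V) (σ σ' : V → NodeState V) : Prop where
  sent_mono : ∀ u, (σ u).sent ⊆ (σ' u).sent
  sent_of : ∀ u v, v ∈ (σ' u).sent → v ∈ (σ u).sent ∨ v = u ∨ v ∈ (σ u).buffer
  buffer_sub : ∀ u, (σ' u).buffer ⊆ (σ u).buffer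
  sent_of_buffer : ∀ u v, v ∈ (σ u).buffer → v ∉ (σ' u).buffer → v ∈ (σ' u).sent
  not_sent : ∀ u v, v ∈ (σ' u).buffer → v ∉ (σ' u).sent
  received_mono : ∀ u, (σ u).received ⊆ (σ' u).received
  received_of : ∀ u v, v ∈ (σ' u).received → v ∈ (σ u).received ∨
    ∃ w, G.Adj u w ∧ (v = w ∨ v ∈ (σ' w).sent ∧ v ∉ (σ w).sent)
  received_new : ∀ u w v, G.Adj u w → v ∈ (σ' w).sent → v ∉ (σ w).sent → v ∈ (σ' u).received
  cnt_ge : ∀ u v, (σ u).cnt v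
    + (Finset.univ.filter fun w => G.Adj u w ∧ v ∈ (σ' w).sent ∧ v ∉ (σ w).sent).card
      ≤ (σ' u).cnt v
  -- A neighbour `v` of `u` whose buffer is empty repeats its own message, and these receptions
  -- match no new entry of a set `sent`. Hence the restriction.
  cnt_eq : ∀ u v, ¬ G.Adj u v → (σ' u).cnt v = (σ u).cnt v
    + (Finset.univ.filter fun w => G.Adj u w ∧ v ∈ (σ' w).sent ∧ v ∉ (σ w).sent).card
  deferred_eq : ∀ u, (σ' u).deferred = (σ u).deferred
  selected_eq : ∀ u, (σ' u).selected = (σ u).selected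

theorem PopRel.refl (G : SimpleGraph V) {σ : V → NodeState V}
    (h : ∀ u v, v ∈ (σ u).buffer → v ∉ (σ u).sent) : PopRel G σ σ where
  sent_mono _ := subset_rfl
  sent_of _ _ hv := .inl hv
  buffer_sub _ := subset_rfl
  sent_of_buffer _ _ h1 h2 := absurd h1 h2
  not_sent := h
  received_mono _ := subset_rfl
  received_of _ _ hv := .inl hv
  received_new _ _ _ _ h1 h2 := absurd h1 h2
  cnt_ge u v := by simp
  cnt_eq u v _ := by simp
  deferred_eq _ := rfl
  selected_eq _ := rfl

theorem PopRel.trans {G : SimpleGraph V} {σ₁ σ₂ σ₃ : V → NodeState V}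
    (h : PopRel G σ₁ σ₂) (h' : PopRel G σ₂ σ₃) : PopRel G σ₁ σ₃ := by
  classical
  -- Since `sent` only grows, each new sender between the first and the third state is new in
  -- exactly one of the two intervals.
  have hcard : ∀ u v,
      (Finset.univ.filter fun w => G.Adj u w ∧ v ∈ (σ₃ w).sent ∧ v ∉ (σ₁ w).sent).card
      = (Finset.univ.filter fun w => G.Adj u w ∧ v ∈ (σ₂ w).sent ∧ v ∉ (σ₁ w).sent).card
        + (Finset.univ.filter fun w => G.Adj u w ∧ v ∈ (σ₃ w).sent ∧ v ∉ (σ₂ w).sent).card := by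
    intro u v
    rw [← Finset.card_union_of_disjoint]
    · congr 1
      ext w
      have h1 := @h.sent_mono w v
      have h2 := @h'.sent_mono w v
      simp only [Finset.mem_filter, Finset.mem_univ, true_and, Finset.mem_union]
      tauto
    · rw [Finset.disjoint_left]
      intro w
      simp only [Finset.mem_filter, Finset.mem_univ, true_and]
      tauto
  refine ⟨fun u => (h.sent_mono u).trans (h'.sent_mono u), ?_,
    fun u => (h'.buffer_sub u).trans (h.buffer_sub u), ?_, h'.not_sent,
    fun u => (h.received_mono u).trans (h'.received_mono u), ?_, ?_, ?_, ?_,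
    fun u => (h'.deferred_eq u).trans (h.deferred_eq u),
    fun u => (h'.selected_eq u).trans (h.selected_eq u)⟩
  · intro u v hv
    rcases h'.sent_of u v hv with h1 | h1 | h1
    · exact h.sent_of u v h1
    · exact .inr (.inl h1)
    · exact .inr (.inr (h.buffer_sub u h1))
  · intro u v h1 h2
    by_cases h3 : v ∈ (σ₂ u).buffer
    · exact h'.sent_of_buffer u v h3 h2
    · exact h'.sent_mono u (h.sent_of_buffer u v h1 h3)
  · intro u v hv
    rcases h'.received_of u v hv with h1 | ⟨w, hw, h1 | ⟨h1, h2⟩⟩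
    · rcases h.received_of u v h1 with h1 | ⟨w, hw, h1 | ⟨h1, h2⟩⟩
      · exact .inl h1
      · exact .inr ⟨w, hw, .inl h1⟩
      · exact .inr ⟨w, hw, .inr ⟨h'.sent_mono w h1, h2⟩⟩
    · exact .inr ⟨w, hw, .inl h1⟩
    · exact .inr ⟨w, hw, .inr ⟨h1, fun h3 => h2 (h.sent_mono w h3)⟩⟩
  · intro u w v hw h1 h2
    by_cases h3 : v ∈ (σ₂ w).sent
    · exact h'.received_mono u (h.received_new u w v hw h3 h2)
    · exact h'.received_new u w v hw h1 h3
  · intro u v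
    have h1 := h.cnt_ge u v
    have h2 := h'.cnt_ge u v
    rw [hcard]
    omega
  · intro u v huv
    rw [hcard, h'.cnt_eq u v huv, h.cnt_eq u v huv]
    ring

theorem popRel_deliver {G : SimpleGraph V} {σ : V → NodeState V} {c : V → V}
    (hσ : ∀ u v, v ∈ (σ u).buffer → v ∉ (σ u).sent)
    (hc : ∀ u, c u ∈ (σ u).buffer ∨ c u = u) :
    PopRel G σ fun u => (σ u).deliver G c u .initial := by
  classical
  refine ⟨fun u => Finset.subset_insert _ _, ?_, fun u => Finset.erase_subset _ _, ?_, ?_,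
    fun u => Finset.subset_union_left, ?_, ?_, ?_, ?_, fun _ => rfl, fun _ => rfl⟩
  · intro u v hv
    rcases Finset.mem_insert.1 hv with rfl | hv
    · exact .inr ((hc u).symm)
    · exact .inl hv
  · intro u v h1 h2
    simp only [NodeState.deliver, Finset.mem_erase, not_and, Finset.mem_insert] at h2 ⊢
    left
    by_contra h3
    exact h2 h3 h1
  · intro u v h1
    simp only [NodeState.deliver, Finset.mem_erase, Finset.mem_insert, not_or] at h1 ⊢
    exact ⟨h1.1, hσ u v h1.2⟩
  · intro u v hv
    rcases Finset.mem_union.1 hv with hv | hv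
    · exact .inl hv
    · right
      simp only [Finset.mem_filter, Finset.mem_univ, true_and, receptions,
        Finset.card_pos] at hv
      obtain ⟨w, hw⟩ := hv
      simp only [Finset.mem_filter, Finset.mem_univ, true_and] at hw
      refine ⟨w, hw.1, ?_⟩
      rcases hc w with h | h
      · right
        rw [hw.2] at h
        exact ⟨by simp [NodeState.deliver, hw.2], hσ w v h⟩
      · left
        rw [← hw.2, h]
  · intro u w v hw h1 h2
    have h3 : v = c w := by
      rcases Finset.mem_insert.1 h1 with h | h
      · exact h
      · exact absurd h h2
    refine Finset.mem_union_right _ ?_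
    simp only [Finset.mem_filter, Finset.mem_univ, true_and, receptions, Finset.card_pos]
    exact ⟨w, by simp [hw, h3]⟩
  · intro u v
    refine Nat.add_le_add_left (Finset.card_le_card fun w => ?_) _
    simp only [Finset.mem_filter, Finset.mem_univ, true_and]
    rintro ⟨hw, h1, h2⟩
    rcases Finset.mem_insert.1 h1 with h | h
    · exact ⟨hw, h.symm⟩
    · exact absurd h h2
  · intro u v huv
    show _ + receptions G c u v = _ + _
    unfold receptions
    congr 2
    ext w
    simp only [Finset.mem_filter, Finset.mem_univ, true_and]
    constructor
    · rintro ⟨hw, h1⟩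
      refine ⟨hw, by simp [NodeState.deliver, h1], hσ w v ?_⟩
      rcases hc w with h | h
      · rwa [h1] at h
      · rw [h1] at h
        exact absurd (h ▸ hw) huv
    · rintro ⟨hw, h1, h2⟩
      rcases Finset.mem_insert.1 h1 with h | h
      · exact ⟨hw, h.symm⟩
      · exact absurd h h2

theorem popRel_of_popStep {G : SimpleGraph V} {σ σ' : V → NodeState V}
    (hσ : ∀ u v, v ∈ (σ u).buffer → v ∉ (σ u).sent) (h : σ' ∈ (popStep G σ).support) :
    PopRel G σ σ' := by
  unfold popStep at h
  rw [PMF.mem_support_map_iff] at h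
  obtain ⟨c, hc, rfl⟩ := h
  exact popRel_deliver hσ fun u => mem_support_popLaw (mem_support_of_independent hc u)

theorem popRel_of_popRun {G : SimpleGraph V} {L : ℕ} {σ σ' : V → NodeState V}
    (hσ : ∀ u v, v ∈ (σ u).buffer → v ∉ (σ u).sent) (h : σ' ∈ (popRun G L σ).support) :
    PopRel G σ σ' := by
  induction L generalizing σ with
  | zero =>
    simp only [popRun, PMF.support_pure, Set.mem_singleton_iff] at h
    rw [h]
    exact PopRel.refl G hσ
  | succ L ih =>
    simp only [popRun, PMF.mem_support_bind_iff] at h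
    obtain ⟨σ₁, h1, h2⟩ := h
    have h3 := popRel_of_popStep hσ h1
    exact h3.trans (ih h3.not_sent h2)

theorem card_sent_le_of_popRun {G : SimpleGraph V} {L : ℕ} {σ σ' : V → NodeState V}
    (h : σ' ∈ (popRun G L σ).support) (u : V) :
    (σ' u).sent.card ≤ (σ u).sent.card + L := by
  induction L generalizing σ with
  | zero =>
    simp only [popRun, PMF.support_pure, Set.mem_singleton_iff] at h
    simp [h]
  | succ L ih =>
    simp only [popRun, PMF.mem_support_bind_iff] at h
    obtain ⟨σ₁, h1, h2⟩ := h
    have h3 := ih h2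
    unfold popStep at h1
    rw [PMF.mem_support_map_iff] at h1
    obtain ⟨c, _, rfl⟩ := h1
    have h4 : ((σ u).deliver G c u .initial).sent.card ≤ (σ u).sent.card + 1 :=
      Finset.card_insert_le _ _
    change (σ' u).sent.card ≤ ((σ u).deliver G c u .initial).sent.card + L at h3
    omega

end Pop

/-! ### Probability that a message is popped during a phase. -/

section PopBounds

variable {V : Type*} [Fintype V] [DecidableEq V]

theorem exists_of_mem_support_popStep {G : SimpleGraph V} {σ σ' : V → NodeState V}
    (h : σ' ∈ (popStep G σ).support) :
    ∃ c : V → V, σ' = fun u => (σ u).deliver G c u .initial := by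
  unfold popStep at h
  rw [PMF.mem_support_map_iff] at h
  obtain ⟨c, _, rfl⟩ := h
  exact ⟨c, rfl⟩

theorem expect_ne_le {β : Type*} [DecidableEq β] (μ : PMF β) (v : β) (y : ℝ≥0∞) :
    expect μ (fun x => if x = v then 0 else y) ≤ (1 - μ v) * y := by
  have h1 : expect μ (fun x => if x = v then 0 else y)
      = expect μ (fun x => if x = v then 0 else 1) * y := by
    rw [← expect_mul_const]
    congr 1
    funext x
    split_ifs <;> simp
  have h2 : expect μ (fun x => if x = v then 0 else 1) + μ v = 1 := by
    have h3 : μ v = expect μ (fun x => if x = v then 1 else 0) := by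
      unfold expect
      rw [tsum_eq_single v]
      · simp
      · intro b hb
        simp [hb]
    rw [h3, ← expect_add]
    refine Eq.trans ?_ (expect_const μ 1)
    congr 1
    funext x
    split_ifs <;> simp
  rw [h1]
  gcongr
  exact (ENNReal.eq_sub_of_add_eq (PMF.apply_ne_top μ v) h2).le

theorem NodeState.tsum_weight (s : NodeState V) :
    ∑' v, s.weight v = ((∑ v ∈ s.buffer, s.prob v : ℝ≥0) : ℝ≥0∞) := by
  rw [tsum_fintype]
  simp only [NodeState.weight]
  rw [Finset.sum_ite_mem, Finset.univ_inter]
  push_cast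
  rfl

/-- Renormalization divides by a remaining mass of at most one, so it only raises probabilities. If
no mass is left, then `q = 0`. -/
theorem le_popLaw {u v : V} {s : NodeState V} {q : ℝ≥0} (hv : v ∈ s.buffer) (hq : q ≤ s.prob v)
    (hsum : ∑ x ∈ s.buffer, s.prob x ≤ 1) : (q : ℝ≥0∞) ≤ s.popLaw u v := by
  unfold NodeState.popLaw
  split_ifs with h0
  · rw [PMF.normalize_apply]
    have h1 : s.weight v = s.prob v := by simp [NodeState.weight, hv]
    have h2 : ∑' v, s.weight v ≤ 1 := by
      rw [NodeState.tsum_weight]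
      exact_mod_cast hsum
    rw [h1]
    calc (q : ℝ≥0∞) ≤ s.prob v := by exact_mod_cast hq
      _ = s.prob v * 1 := (mul_one _).symm
      _ ≤ _ := by
        gcongr
        exact ENNReal.one_le_inv.2 h2
  · have h1 : s.prob v = 0 := by
      push Not at h0
      rw [NodeState.tsum_weight, ENNReal.coe_eq_zero] at h0
      exact (Finset.sum_eq_zero_iff.1 h0) v hv
    rw [h1] at hq
    simp [le_zero_iff.1 hq]

/-- A message that is popped with probability at least `q` as long as it stays in the buffer
survives `L` rounds with probability at most `(1 - q) ^ L`. -/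
theorem expect_mem_buffer_popRun_le (G : SimpleGraph V) {u v : V} {q : ℝ≥0} (L : ℕ)
    (σ : V → NodeState V) (hq : q ≤ (σ u).prob v)
    (hsum : ∑ x ∈ (σ u).buffer, (σ u).prob x ≤ 1) :
    expect (popRun G L σ) (fun σ' => if v ∈ (σ' u).buffer then 1 else 0)
      ≤ if v ∈ (σ u).buffer then (1 - (q : ℝ≥0∞)) ^ L else 0 := by
  induction L generalizing σ with
  | zero => simp [popRun, expect_pure]
  | succ L ih =>
    simp only [popRun, expect_bind]
    have h1 : expect (popStep G σ) (fun σ₁ => expect (popRun G L σ₁)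
          (fun σ' => if v ∈ (σ' u).buffer then 1 else 0))
        ≤ expect (popStep G σ)
          (fun σ₁ => if v ∈ (σ₁ u).buffer then (1 - (q : ℝ≥0∞)) ^ L else 0) := by
      refine expect_mono fun σ₁ h => ?_
      obtain ⟨c, rfl⟩ := exists_of_mem_support_popStep h
      -- `prob` is fixed during the phase and the buffer only shrinks, so both hypotheses persist.
      refine ih _ hq (le_trans ?_ hsum)
      exact Finset.sum_le_sum_of_subset (Finset.erase_subset _ _)
    refine h1.trans ?_
    unfold popStep
    rw [expect_map]
    have h2 := expect_independent_apply (fun u => (σ u).popLaw u) u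
      (fun x => if v ∈ (σ u).buffer.erase x then (1 - (q : ℝ≥0∞)) ^ L else 0)
    refine h2.le.trans ?_
    split_ifs with hv
    · have h3 := expect_ne_le ((σ u).popLaw u) v ((1 - (q : ℝ≥0∞)) ^ L)
      rw [pow_succ, mul_comm]
      refine le_trans (expect_mono fun x _ => ?_) (h3.trans ?_)
      · by_cases hx : x = v
        · simp [hx]
        · rw [if_neg hx]
          split_ifs <;> simp
      · gcongr
        exact le_popLaw hv hq hsum
    · refine le_trans (expect_mono (g := fun _ => 0) fun x _ => ?_) (expect_const _ 0).le
      simp [hv]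

theorem expect_popLaw_of_uniform {u : V} {s : NodeState V} {a : ℝ≥0} (ha : a ≠ 0)
    (hprob : ∀ v, s.prob v = a) (hb : s.buffer.Nonempty) (f : V → ℝ≥0∞) :
    expect (s.popLaw u) f = (∑ v ∈ s.buffer, f v) / s.buffer.card := by
  have hsum : ∑' v, s.weight v = s.buffer.card * (a : ℝ≥0∞) := by
    rw [NodeState.tsum_weight]
    simp [hprob]
  have hb' : (s.buffer.card : ℝ≥0∞) ≠ 0 := by
    simpa using hb.ne_empty
  have ha' : (a : ℝ≥0∞) ≠ 0 := by simpa using ha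
  unfold NodeState.popLaw expect
  rw [dif_pos (by rw [hsum]; exact mul_ne_zero hb' ha')]
  simp only [PMF.normalize_apply, hsum]
  rw [tsum_fintype, ENNReal.div_eq_inv_mul, Finset.mul_sum]
  rw [← Finset.sum_subset (Finset.subset_univ s.buffer)]
  · refine Finset.sum_congr rfl fun v hv => ?_
    simp only [NodeState.weight, hv, if_true, hprob]
    congr 1
    rw [ENNReal.mul_inv (.inl hb') (.inl (by simp)), mul_comm _ (a : ℝ≥0∞)⁻¹, ← mul_assoc,
      ENNReal.mul_inv_cancel ha' (by simp), one_mul]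
  · intro v _ hv
    simp [NodeState.weight, hv]

/-- The expectation of `z ^ [x ∈ A]` for a random `m`-element subset `A` of `b ∋ x` elements. -/
def hitFactor (z : ℝ≥0∞) (b m : ℕ) : ℝ≥0∞ := (((b - m : ℕ) : ℝ≥0∞) + z * m) / b

/-- One-step recursion of sampling without replacement: the first draw hits `v`, or `L` draws from
the other elements and `v` remain. -/
theorem sum_hitFactor {B : Finset V} {v : V} (hv : v ∈ B) {L : ℕ} (hL : L + 1 ≤ B.card)
    (z : ℝ≥0∞) :
    (∑ x ∈ B, if x = v then z else hitFactor z (B.card - 1) L) / B.card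
      = hitFactor z B.card (L + 1) := by
  rw [Finset.sum_ite, Finset.filter_eq' B v, if_pos hv, Finset.sum_singleton, Finset.sum_const,
    Finset.filter_ne' B v, Finset.card_erase_of_mem hv]
  unfold hitFactor
  congr 1
  rw [nsmul_eq_mul]
  -- A singleton is treated apart, as `hitFactor` would divide by `B.card - 1 = 0`.
  by_cases hb : B.card = 1
  · have h0 : L = 0 := by omega
    simp [hb, h0]
  · have hb' : B.card - 1 ≠ 0 := by
      have := Finset.card_pos.2 ⟨v, hv⟩
      omega
    rw [ENNReal.mul_div_cancel (by exact_mod_cast hb') (by simp)]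
    rw [show B.card - (L + 1) = B.card - 1 - L by omega]
    push_cast
    ring

/-- Over `L` rounds in which the nodes pop uniformly from their buffers, the nodes of `W` send
their target messages independently. -/
theorem expect_prod_popRun (G : SimpleGraph V) (W : Finset V) (f : V → V) (z : ℝ≥0∞) (L : ℕ)
    (σ : V → NodeState V)
    (hprob : ∀ x ∈ W, ∃ a : ℝ≥0, a ≠ 0 ∧ ∀ v, (σ x).prob v = a)
    (hcard : ∀ x ∈ W, L ≤ (σ x).buffer.card)
    (htarget : ∀ x ∈ W, f x ∈ (σ x).sent ∨ f x ∈ (σ x).buffer) :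
    expect (popRun G L σ) (fun σ' => ∏ x ∈ W, if f x ∈ (σ' x).sent then z else 1)
      ≤ ∏ x ∈ W, if f x ∈ (σ x).sent then z else hitFactor z (σ x).buffer.card L := by
  induction L generalizing σ with
  | zero =>
    simp only [popRun, expect_pure]
    refine Finset.prod_le_prod' fun x hx => ?_
    split_ifs with h
    · exact le_rfl
    · have h1 := (htarget x hx).resolve_left h
      have h2 : ((σ x).buffer.card : ℝ≥0∞) ≠ 0 := by simpa using Finset.ne_empty_of_mem h1
      simp [hitFactor, ENNReal.div_self h2]
  | succ L ih =>
    simp only [popRun, expect_bind]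
    have h1 : expect (popStep G σ) (fun σ₁ => expect (popRun G L σ₁)
          (fun σ' => ∏ x ∈ W, if f x ∈ (σ' x).sent then z else 1))
        ≤ expect (popStep G σ) (fun σ₁ => ∏ x ∈ W,
            if f x ∈ (σ₁ x).sent then z else hitFactor z (σ₁ x).buffer.card L) := by
      refine expect_mono fun σ₁ h => ?_
      obtain ⟨c, rfl⟩ := exists_of_mem_support_popStep h
      refine ih _ hprob (fun x hx => ?_) fun x hx => ?_
      · have h2 := hcard x hx
        have h3 : (σ x).buffer.card - 1 ≤ ((σ x).buffer.erase (c x)).card :=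
          Finset.pred_card_le_card_erase
        show L ≤ ((σ x).buffer.erase (c x)).card
        omega
      · show f x ∈ insert (c x) (σ x).sent ∨ f x ∈ (σ x).buffer.erase (c x)
        have h2 := htarget x hx
        rw [Finset.mem_insert, Finset.mem_erase]
        tauto
    refine h1.trans ?_
    unfold popStep
    rw [expect_map]
    -- Given the state, the pops of one round are independent, so the bound from the induction
    -- factors over the nodes and each factor obeys `sum_hitFactor`.
    refine (expect_independent_prod_mem (fun u => (σ u).popLaw u) W
      (fun x y => if f x ∈ insert y (σ x).sent then z
        else hitFactor z ((σ x).buffer.erase y).card L)).le.trans ?_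
    refine Finset.prod_le_prod' fun x hx => ?_
    split_ifs with h
    · refine (expect_mono fun y _ => ?_).trans (expect_const _ z).le
      rw [if_pos (Finset.mem_insert_of_mem h)]
    · have h3 := (htarget x hx).resolve_left h
      obtain ⟨a, ha, hp⟩ := hprob x hx
      rw [expect_popLaw_of_uniform ha hp ⟨_, h3⟩, ← sum_hitFactor h3 (hcard x hx)]
      gcongr with y hy
      by_cases hyx : y = f x
      · simp [hyx]
      · simp [hyx, Ne.symm hyx, h, Finset.card_erase_of_mem hy]

end PopBounds

/-! ### The random selection that ends a shuffle phase. -/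

section Selection

variable {V : Type*} [Fintype V] [DecidableEq V]

theorem expect_uniformOfFinset {β : Type*} (S : Finset β) (hS : S.Nonempty) (f : β → ℝ≥0∞) :
    expect (PMF.uniformOfFinset S hS) f = (∑ a ∈ S, f a) / S.card := by
  classical
  unfold expect
  rw [ENNReal.div_eq_inv_mul, Finset.mul_sum, tsum_eq_sum (s := S)]
  · exact Finset.sum_congr rfl fun a ha => by
      rw [PMF.uniformOfFinset_apply_of_mem hS ha]
  · intro a ha
    rw [PMF.uniformOfFinset_apply_of_notMem hS ha, zero_mul]

theorem mem_support_selectionLaw {p : Params} {s : NodeState V} {A : Finset V}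
    (h : A ∈ (s.selectionLaw p).support) :
    A ⊆ s.candidates p ∧ A.card = min (4 * p.tau) (s.candidates p).card := by
  unfold NodeState.selectionLaw at h
  rw [PMF.mem_support_uniformOfFinset_iff] at h
  exact Finset.mem_powersetCard.1 h

/-- A proportion `m/r` of the `m`-subsets of an `r`-set contains a given element, by `C(r-1,m) r =
(r-m) C(r,m)`. So the moment is the one of `m` uniform pops. -/
theorem expect_selectionLaw_mem {p : Params} {s : NodeState V} {v : V}
    (hv : v ∈ s.candidates p) (h : 4 * p.tau ≤ (s.candidates p).card) (z : ℝ≥0∞) :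
    expect (s.selectionLaw p) (fun A => if v ∈ A then z else 1)
      = hitFactor z (s.candidates p).card (4 * p.tau) := by
  unfold NodeState.selectionLaw
  rw [expect_uniformOfFinset]
  rw [min_eq_left h]
  set R := s.candidates p
  set m := 4 * p.tau
  have hr : 0 < R.card := Finset.card_pos.2 ⟨v, hv⟩
  have h1 : (Finset.powersetCard m R).filter (fun A => v ∉ A)
      = Finset.powersetCard m (R.erase v) := by
    ext A
    simp only [Finset.mem_filter, Finset.mem_powersetCard, Finset.subset_erase]
    tauto
  have h2 : ((Finset.powersetCard m R).filter (fun A => v ∉ A)).card * R.card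
      = (R.card - m) * (R.card.choose m) := by
    rw [h1, Finset.card_powersetCard, Finset.card_erase_of_mem hv]
    have := Nat.choose_mul_succ_eq (R.card - 1) m
    rw [show R.card - 1 + 1 = R.card by omega] at this
    rw [this, mul_comm]
  have h3 : ((Finset.powersetCard m R).filter (fun A => v ∈ A)).card * R.card
      = m * (R.card.choose m) := by
    have h4 := Finset.card_filter_add_card_filter_not (s := Finset.powersetCard m R)
      (fun A => v ∈ A)
    rw [Finset.card_powersetCard] at h4
    have h5 : m * R.card.choose m + (R.card - m) * R.card.choose m
        = R.card.choose m * R.card := by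
      rw [← add_mul, Nat.add_sub_cancel' h, mul_comm]
    have h6 := congrArg (· * R.card) h4
    simp only [add_mul] at h6
    omega
  rw [Finset.sum_ite, Finset.sum_const, Finset.sum_const, nsmul_eq_mul, nsmul_eq_mul, mul_one,
    Finset.card_powersetCard]
  unfold hitFactor
  have hr' : (R.card : ℝ≥0∞) ≠ 0 := by simpa using hr.ne'
  have hc : (R.card.choose m : ℝ≥0∞) ≠ 0 := by
    simpa using (Nat.choose_pos h).ne'
  rw [ENNReal.div_eq_div_iff hr' (by simp) hc (by simp)]
  have h2' : (((Finset.powersetCard m R).filter (fun A => v ∉ A)).card : ℝ≥0∞) * R.card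
      = ((R.card - m : ℕ) : ℝ≥0∞) * (R.card.choose m : ℕ) := by exact_mod_cast h2
  have h3' : (((Finset.powersetCard m R).filter (fun A => v ∈ A)).card : ℝ≥0∞) * R.card
      = (m : ℝ≥0∞) * (R.card.choose m : ℕ) := by exact_mod_cast h3
  calc _ = (((Finset.powersetCard m R).filter (fun A => v ∈ A)).card : ℝ≥0∞) * R.card * z
        + ((Finset.powersetCard m R).filter (fun A => v ∉ A)).card * R.card := by ring
    _ = _ := by
      rw [h2', h3']
      ring

/-- Factor by factor, `2 (a - i) ≤ b - i`. -/
theorem two_pow_mul_descFactorial_le {a b : ℕ} (h : 2 * a ≤ b) (m : ℕ) :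
    2 ^ m * a.descFactorial m ≤ b.descFactorial m := by
  induction m with
  | zero => simp
  | succ m ih =>
    rw [Nat.descFactorial_succ, Nat.descFactorial_succ, pow_succ]
    calc 2 ^ m * 2 * ((a - m) * a.descFactorial m)
        = (2 * (a - m)) * (2 ^ m * a.descFactorial m) := by ring
      _ ≤ (b - m) * b.descFactorial m := Nat.mul_le_mul (by omega) ih

theorem two_pow_mul_choose_le {a b : ℕ} (h : 2 * a ≤ b) (m : ℕ) :
    2 ^ m * a.choose m ≤ b.choose m := by
  have h1 := two_pow_mul_descFactorial_le h m
  rw [Nat.descFactorial_eq_factorial_mul_choose, Nat.descFactorial_eq_factorial_mul_choose] at h1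
  refine Nat.le_of_mul_le_mul_left ?_ (Nat.factorial_pos m)
  calc _ = 2 ^ m * (m.factorial * a.choose m) := by ring
    _ ≤ _ := h1

/-- The ratio `C(|D|,m) / C(|R|,m)` is at most `2^(-m)` when `D` is at most half of `R`. With `D`
one of two candidate cliques, this makes one-sided selections unlikely. -/
theorem expect_selectionLaw_subset_le {p : Params} {s : NodeState V} {D : Finset V}
    (h : 4 * p.tau ≤ (s.candidates p).card) (hD : 2 * D.card ≤ (s.candidates p).card) :
    expect (s.selectionLaw p) (fun A => if A ⊆ D then 1 else 0) ≤ (1 / 2) ^ (4 * p.tau) := by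
  unfold NodeState.selectionLaw
  rw [expect_uniformOfFinset]
  rw [min_eq_left h]
  set R := s.candidates p
  set m := 4 * p.tau
  rw [Finset.sum_boole, Finset.card_powersetCard]
  have h1 : ((Finset.powersetCard m R).filter (fun A => A ⊆ D)).card ≤ D.card.choose m := by
    rw [← Finset.card_powersetCard]
    refine Finset.card_le_card fun A => ?_
    simp only [Finset.mem_filter, Finset.mem_powersetCard]
    tauto
  have h2 := two_pow_mul_choose_le hD m
  have hc : (R.card.choose m : ℝ≥0∞) ≠ 0 := by
    simpa using (Nat.choose_pos h).ne'
  rw [ENNReal.div_le_iff hc (by simp)]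
  calc (((Finset.powersetCard m R).filter (fun A => A ⊆ D)).card : ℝ≥0∞)
      ≤ (D.card.choose m : ℕ) := by exact_mod_cast h1
    _ = (1 / 2) ^ m * (2 ^ m * (D.card.choose m : ℕ)) := by
      rw [← mul_assoc, ← mul_pow, ENNReal.div_mul_cancel (by simp) (by simp), one_pow, one_mul]
    _ ≤ _ := by
      gcongr
      exact_mod_cast h2

end Selection

/-! ### Shuffle phases, deterministic up to the selection. -/

section Shuffle

variable {V : Type*} [Fintype V] [DecidableEq V]

theorem independent_pure {β : Type*} [Fintype β] (g : V → β) :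
    independent (fun u => PMF.pure (g u)) = PMF.pure g := by
  classical
  ext c
  show ∏ u, PMF.pure (g u) (c u) = PMF.pure g c
  simp only [PMF.pure_apply]
  by_cases h : c = g
  · simp [h]
  · rw [if_neg h]
    obtain ⟨u, hu⟩ := Function.ne_iff.1 h
    exact Finset.prod_eq_zero (Finset.mem_univ u) (if_neg hu)

/-- Peels off the last round instead of the first one: in a shuffle phase only the last round is
random. -/
theorem run_succ (p : Params) (G : SimpleGraph V) (tie : TieRule V) (t m : ℕ)
    (σ : V → NodeState V) :
    run p G tie t (m + 1) σ = (run p G tie t m σ).bind (step p G tie (t + m)) := by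
  induction m generalizing t σ with
  | zero => simp [run, PMF.bind_pure]
  | succ m ih =>
    rw [run]
    conv_rhs => rw [run, PMF.bind_bind]
    congr 1
    funext τ
    rw [ih, show t + 1 + m = t + (m + 1) by ring]

open Classical in
/-- The pathwise relation of the global state `σ` before a shuffle phase, in which the nodes have
to send the messages of `F`, and the global state `σ'` after `m` of its rounds. -/
structure ShuffleRel (G : SimpleGraph V) (F : V → Finset V) (σ : V → NodeState V) (m : ℕ)
    (σ' : V → NodeState V) : Prop where
  received_eq : ∀ u, (σ' u).received = (σ u).received
  sent_eq : ∀ u, (σ' u).sent = (σ u).sent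
  cnt_eq : ∀ u, (σ' u).cnt = (σ u).cnt
  buffer_sub : ∀ u, (σ' u).buffer ⊆ F u
  -- The subtraction is truncated: once `m` reaches the size of `F u`, the buffer is empty.
  buffer_card : ∀ u, (σ' u).buffer.card ≤ (F u).card - m
  phasecnt_ge : ∀ u v, (if v ∈ F u then 1 else 0)
    + (Finset.univ.filter fun w => G.Adj u w ∧ v ∈ F w ∧ v ∉ (σ' w).buffer).card
      ≤ (σ' u).phasecnt v
  -- The restriction has the same reason as in `PopRel.cnt_eq`.
  phasecnt_eq : ∀ u v, ¬ G.Adj u v → (σ' u).phasecnt v = (if v ∈ F u then 1 else 0)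
    + (Finset.univ.filter fun w => G.Adj u w ∧ v ∈ F w ∧ v ∉ (σ' w).buffer).card

theorem ShuffleRel.deliver {G : SimpleGraph V} {F : V → Finset V} {σ σ' : V → NodeState V} {m : ℕ}
    (h : ShuffleRel G F σ m σ') {c : V → V}
    (hc : ∀ u, (σ' u).buffer.Nonempty → c u ∈ (σ' u).buffer)
    (hc' : ∀ u, ¬ (σ' u).buffer.Nonempty → c u = u) (i : ℕ) :
    ShuffleRel G F σ (m + 1) fun u => (σ' u).deliver G c u (.shuffle i) := by
  classical
  have hsub : ∀ u v, (Finset.univ.filter fun w => G.Adj u w ∧ v ∈ F w ∧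
      v ∉ ((σ' w).buffer.erase (c w))) ⊆
      (Finset.univ.filter fun w => G.Adj u w ∧ v ∈ F w ∧ v ∉ (σ' w).buffer) ∪
      (Finset.univ.filter fun w => G.Adj u w ∧ c w = v) := by
    intro u v w
    simp only [Finset.mem_filter, Finset.mem_univ, true_and, Finset.mem_union,
      Finset.mem_erase, not_and']
    rintro ⟨hw, h1, h2⟩
    by_cases h3 : v ∈ (σ' w).buffer
    · right
      refine ⟨hw, ?_⟩
      have h4 := h2 h3
      push Not at h4
      exact h4.symm
    · exact .inl ⟨hw, h1, h3⟩
  refine ⟨h.received_eq, h.sent_eq, h.cnt_eq,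
    fun u => (Finset.erase_subset _ _).trans (h.buffer_sub u), ?_, ?_, ?_⟩
  · intro u
    show ((σ' u).buffer.erase (c u)).card ≤ _
    have h1 := h.buffer_card u
    by_cases hb : (σ' u).buffer.Nonempty
    · rw [Finset.card_erase_of_mem (hc u hb)]
      omega
    · rw [Finset.not_nonempty_iff_eq_empty] at hb
      simp [hb]
  · intro u v
    have h1 := h.phasecnt_ge u v
    have h2 := (Finset.card_le_card (hsub u v)).trans (Finset.card_union_le _ _)
    refine (Nat.add_le_add_left h2 _).trans ?_
    show _ ≤ (σ' u).phasecnt v + receptions G c u v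
    unfold receptions
    omega
  · intro u v huv
    have h1 := h.phasecnt_eq u v huv
    show (σ' u).phasecnt v + receptions G c u v = _
    unfold receptions
    rw [h1, add_assoc]
    congr 1
    rw [← Finset.card_union_of_disjoint]
    · congr 1
      refine Finset.Subset.antisymm ?_ (hsub u v)
      intro w
      simp only [NodeState.deliver, Finset.mem_filter, Finset.mem_univ, true_and, Finset.mem_union,
        Finset.mem_erase, not_and']
      rintro (⟨hw, h2, h3⟩ | ⟨hw, h2⟩)
      · exact ⟨hw, h2, fun h4 => absurd h4 h3⟩
      · refine ⟨hw, ?_, fun _ => by simp [h2]⟩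
        by_cases hb : (σ' w).buffer.Nonempty
        · exact h2 ▸ h.buffer_sub w (hc w hb)
        · have h3 := hc' w hb
          rw [h2] at h3
          exact absurd (h3 ▸ hw) huv
    · rw [Finset.disjoint_left]
      intro w
      simp only [Finset.mem_filter, Finset.mem_univ, true_and]
      rintro ⟨hw, h2, h3⟩ ⟨_, h4⟩
      by_cases hb : (σ' w).buffer.Nonempty
      · exact h3 (h4 ▸ hc w hb)
      · have h5 := hc' w hb
        rw [h4] at h5
        exact absurd (h5 ▸ hw) huv

theorem shuffleMessage_mem {u : V} {tie : V ↪ ℕ} {s : NodeState V} (h : s.buffer.Nonempty) :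
    s.shuffleMessage u tie ∈ s.buffer := by
  unfold NodeState.shuffleMessage
  rw [dif_pos h]
  exact (s.buffer.exists_min_image tie h).choose_spec.1

theorem shuffleMessage_of_empty {u : V} {tie : V ↪ ℕ} {s : NodeState V}
    (h : ¬ s.buffer.Nonempty) : s.shuffleMessage u tie = u := by
  unfold NodeState.shuffleMessage
  rw [dif_neg h]

/-- The global state at the end of round `t` of a shuffle phase, before a selection is made. -/
def shuffleNext (p : Params) (G : SimpleGraph V) (tie : TieRule V) (t i : ℕ)
    (σ : V → NodeState V) : V → NodeState V :=
  let ready : V → NodeState V := fun u => (σ u).prepare p (tie u t (σ u)) (.shuffle i)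
  fun u => (ready u).deliver G (fun w => (ready w).shuffleMessage w (tie w t (ready w))) u
    (.shuffle i)

theorem step_of_shuffle {p : Params} {G : SimpleGraph V} {tie : TieRule V} {t i : ℕ}
    (h : p.stage t = .shuffle i) (σ : V → NodeState V) :
    step p G tie t σ = if i + 1 = 8 * p.tau then
        (independent fun u => (shuffleNext p G tie t i σ u).selectionLaw p).map
          fun A u => (shuffleNext p G tie t i σ u).finishShuffle p (A u)
      else PMF.pure (shuffleNext p G tie t i σ) := by
  unfold step
  rw [h]
  simp only [NodeState.messageLaw]
  rw [independent_pure, PMF.pure_bind]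
  rfl

theorem run_shuffle_phase {p : Params} {G : SimpleGraph V} {tie : TieRule V} {t : ℕ}
    (hτ : 0 < p.tau) (h : ∀ j < 8 * p.tau, p.stage (t + j) = .shuffle j) (σ : V → NodeState V) :
    ∃ σ', ShuffleRel G (fun u => (σ u).fresh p ∩ (σ u).unsent) σ (8 * p.tau) σ' ∧
      run p G tie t (8 * p.tau) σ = (independent fun u => (σ' u).selectionLaw p).map
        fun A u => (σ' u).finishShuffle p (A u) := by
  classical
  set F : V → Finset V := fun u => (σ u).fresh p ∩ (σ u).unsent with hF
  have hnext : ∀ m σ₁, ShuffleRel G F σ m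
      (fun u => (σ₁ u).prepare p (tie u (t + m) (σ₁ u)) (.shuffle m)) →
      ShuffleRel G F σ (m + 1) (shuffleNext p G tie (t + m) m σ₁) := fun m σ₁ h1 =>
    h1.deliver (fun u hu => shuffleMessage_mem hu) (fun u hu => shuffleMessage_of_empty hu) m
  -- The relation is stated after the preparation of round `m`, since `buffer` and `phasecnt` are
  -- loaded by the preparation of round `0`; later ones change nothing.
  have key : ∀ m < 8 * p.tau, ∃ σ₁, run p G tie t m σ = PMF.pure σ₁ ∧
      ShuffleRel G F σ m
        (fun u => (σ₁ u).prepare p (tie u (t + m) (σ₁ u)) (.shuffle m)) := by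
    intro m
    induction m with
    | zero =>
      intro _
      refine ⟨σ, rfl, fun _ => rfl, fun _ => rfl, fun _ => rfl, fun _ => subset_rfl,
        fun _ => le_rfl, ?_, ?_⟩
      · intro u v
        have : (Finset.univ.filter fun w => G.Adj u w ∧ v ∈ F w ∧ v ∉ F w) = ∅ := by
          ext w; simp
        exact (congrArg (fun S => (if v ∈ F u then 1 else 0) + Finset.card S) this).le
      · intro u v _
        have : (Finset.univ.filter fun w => G.Adj u w ∧ v ∈ F w ∧ v ∉ F w) = ∅ := by
          ext w; simp
        exact (congrArg (fun S => (if v ∈ F u then 1 else 0) + Finset.card S) this).symm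
    | succ m ih =>
      intro hm
      obtain ⟨σ₁, h1, h2⟩ := ih (by omega)
      refine ⟨shuffleNext p G tie (t + m) m σ₁, ?_, hnext m σ₁ h2⟩
      rw [run_succ, h1, PMF.pure_bind, step_of_shuffle (h m (by omega)), if_neg (by omega)]
  obtain ⟨σ₁, h1, h2⟩ := key (8 * p.tau - 1) (by omega)
  have h3 := hnext _ _ h2
  rw [show 8 * p.tau - 1 + 1 = 8 * p.tau by omega] at h3
  refine ⟨_, h3, ?_⟩
  conv_lhs => rw [show 8 * p.tau = 8 * p.tau - 1 + 1 by omega]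
  rw [run_succ, h1, PMF.pure_bind, step_of_shuffle (h (8 * p.tau - 1) (by omega)),
    if_pos (by omega)]

end Shuffle

/-! ### The schedule -/

section Schedule

/-- The round with which the ranking phase number `r` starts, counted from `0`. -/
def Params.rankingStart (p : Params) (r : ℕ) : ℕ := 1 + p.tau + r * (p.tauRank + 8 * p.tau)

theorem Params.stage_random (p : Params) {j : ℕ} (hj : j < p.tau) :
    p.stage (1 + j) = .random j := by
  unfold Params.stage
  rw [if_neg (by omega), if_pos (by omega)]
  congr 1
  omega

theorem Params.stage_ranking (p : Params) (r : ℕ) {j : ℕ} (hj : j < p.tauRank) :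
    p.stage (p.rankingStart r + j) = .ranking j := by
  unfold Params.stage Params.rankingStart
  rw [if_neg (by omega), if_neg (by omega)]
  have h1 : (1 + p.tau + r * (p.tauRank + 8 * p.tau) + j - 1 - p.tau)
      % (p.tauRank + 8 * p.tau) = j := by
    rw [show 1 + p.tau + r * (p.tauRank + 8 * p.tau) + j - 1 - p.tau
      = j + r * (p.tauRank + 8 * p.tau) by omega, Nat.add_mul_mod_self_right,
      Nat.mod_eq_of_lt (by omega)]
  simp only [h1, if_pos hj]

theorem Params.stage_shuffle (p : Params) (r : ℕ) {j : ℕ} (hj : j < 8 * p.tau) :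
    p.stage (p.rankingStart r + p.tauRank + j) = .shuffle j := by
  unfold Params.stage Params.rankingStart
  rw [if_neg (by omega), if_neg (by omega)]
  have h1 : (1 + p.tau + r * (p.tauRank + 8 * p.tau) + p.tauRank + j - 1 - p.tau)
      % (p.tauRank + 8 * p.tau) = p.tauRank + j := by
    rw [show 1 + p.tau + r * (p.tauRank + 8 * p.tau) + p.tauRank + j - 1 - p.tau
      = p.tauRank + j + r * (p.tauRank + 8 * p.tau) by omega, Nat.add_mul_mod_self_right,
      Nat.mod_eq_of_lt (by omega)]
  simp only [h1]
  rw [if_neg (by omega)]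
  congr 1
  omega

theorem Params.rankingStart_succ (p : Params) (r : ℕ) :
    p.rankingStart (r + 1) = p.rankingStart r + p.tauRank + 8 * p.tau := by
  unfold Params.rankingStart
  ring

end Schedule

/-! ### Completeness is never lost -/

section Monotone

variable {V : Type*} [Fintype V] [DecidableEq V]

theorem received_subset_of_step {p : Params} {G : SimpleGraph V} {tie : TieRule V} {t : ℕ}
    {σ σ' : V → NodeState V} (h : σ' ∈ (step p G tie t σ).support) (u : V) :
    (σ u).received ⊆ (σ' u).received := by
  have hprep : ∀ st, ((σ u).prepare p (tie u t (σ u)) st).received = (σ u).received := by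
    intro st
    unfold NodeState.prepare
    split <;> rfl
  have hdel : ∀ c st, (σ u).received ⊆
      (((σ u).prepare p (tie u t (σ u)) st).deliver G c u st).received := by
    intro c st
    rw [← hprep st]
    unfold NodeState.deliver
    split
    · exact subset_rfl
    · exact Finset.subset_union_left
  unfold step at h
  rw [PMF.mem_support_bind_iff] at h
  obtain ⟨c, _, h⟩ := h
  split at h
  next i hi =>
    split_ifs at h with h8
    · rw [PMF.mem_support_map_iff] at h
      obtain ⟨A, _, rfl⟩ := h
      exact (hdel c _).trans Finset.subset_union_left
    · rw [PMF.mem_support_pure_iff] at h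
      rw [h]
      exact hdel c _
  next =>
    rw [PMF.mem_support_pure_iff] at h
    rw [h]
    exact hdel c _

theorem complete_of_run {p : Params} {G : SimpleGraph V} {tie : TieRule V} {t m : ℕ}
    {σ σ' : V → NodeState V} (h : σ' ∈ (run p G tie t m σ).support) (hσ : Complete σ) :
    Complete σ' := by
  induction m generalizing t σ with
  | zero =>
    simp only [run, PMF.support_pure, Set.mem_singleton_iff] at h
    rwa [h]
  | succ m ih =>
    simp only [run, PMF.mem_support_bind_iff] at h
    obtain ⟨σ₁, h1, h2⟩ := h
    exact ih h2 fun u v => received_subset_of_step h1 u (hσ u v)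

/-- The execution fails to complete by round `t + m` with at most the probability with which it
fails by round `t`. -/
theorem failProb_complete_mono (p : Params) (G : SimpleGraph V) (tie : TieRule V) (t m : ℕ) :
    failProb (execution p G tie (t + m)) Complete ≤ failProb (execution p G tie t) Complete := by
  rw [execution_add]
  refine (failProb_bind_le (Q := Complete) (ε := 0) fun σ _ hσ => ?_).trans (add_zero _).le
  refine (failProb_mono (Q := fun _ => True) fun σ' h' _ => complete_of_run h' hσ).trans ?_
  unfold failProb
  simp [expect_const]

end Monotone

/-! ### The geometry of the path of cliques -/

section Geometry

variable {N k : ℕ}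

/-- The distance of the cliques of two nodes on the path of cliques. -/
def cliqueDist (u v : Fin N × Fin k) : ℕ := (u.1.val - v.1.val) + (v.1.val - u.1.val)

theorem cliqueDist_comm (u v : Fin N × Fin k) : cliqueDist u v = cliqueDist v u := by
  unfold cliqueDist
  omega

theorem eq_of_cliqueDist_eq_zero {u v : Fin N × Fin k} (h : cliqueDist u v = 0)
    (h2 : u.2 = v.2) : u = v := by
  refine Prod.ext (Fin.ext ?_) h2
  unfold cliqueDist at h
  omega

theorem cliquePath_adj {n k : ℕ} {u w : Fin (n / k) × Fin k} :
    (cliquePath n k).Adj u w ↔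
      cliqueDist u w = 1 ∧ w.2 = u.2 ∨ cliqueDist u w = 0 ∧ w.2 ≠ u.2 := by
  unfold cliquePath cliqueDist
  rw [SimpleGraph.boxProd_adj, SimpleGraph.pathGraph_adj, SimpleGraph.top_adj,
    Fin.ext_iff (a := u.1) (b := w.1), ne_comm]
  constructor
  · rintro (⟨h | h, h2⟩ | ⟨h, h2⟩)
    · exact .inl ⟨by omega, h2.symm⟩
    · exact .inl ⟨by omega, h2.symm⟩
    · exact .inr ⟨by omega, h⟩
  · rintro (⟨h, h2⟩ | ⟨h, h2⟩)
    · exact .inl ⟨by omega, h2.symm⟩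
    · exact .inr ⟨h2, by omega⟩

theorem cliqueDist_le_one_of_adj {n k : ℕ} {u w : Fin (n / k) × Fin k}
    (h : (cliquePath n k).Adj u w) : cliqueDist u w ≤ 1 := by
  rcases cliquePath_adj.1 h with h | h <;> omega

/-- At most three nodes are the node of layer `j` of the clique of `u` or one of the two
neighbours of `u` in the adjacent cliques. -/
theorem card_le_three (u : Fin N × Fin k) (j : Fin k) (S : Finset (Fin N × Fin k))
    (hS : ∀ w ∈ S, cliqueDist u w = 0 ∧ w.2 = j ∨ cliqueDist u w = 1 ∧ w.2 = u.2) :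
    S.card ≤ 3 := by
  refine (Finset.card_le_card_of_injOn (fun w => w.1.val)
    (t := {u.1.val, u.1.val + 1, u.1.val - 1}) ?_ ?_).trans Finset.card_le_three
  · intro w hw
    have h := hS w hw
    unfold cliqueDist at h
    simp only [Finset.coe_insert, Finset.coe_singleton, Set.mem_insert_iff, Set.mem_singleton_iff]
    omega
  · intro w hw w' hw' h
    simp only at h
    have h1 := hS w hw
    have h2 := hS w' hw'
    unfold cliqueDist at h1 h2
    refine Prod.ext (Fin.ext h) ?_
    rcases h1 with ⟨h1, e1⟩ | ⟨h1, e1⟩ <;> rcases h2 with ⟨h2, e2⟩ | ⟨h2, e2⟩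
    · rw [e1, e2]
    · omega
    · omega
    · rw [e1, e2]

/-- The set splits by `u.1 < v.1`. The representative `v₀` fixes a side that does occur, so nothing
has to be shown for an empty side. -/
theorem card_le_of_sides (S : Finset (Fin N × Fin k)) (u : Fin N × Fin k) (M : ℕ)
    (h : ∀ v₀ ∈ S, (S.filter fun v => u.1 < v.1 ↔ u.1 < v₀.1).card ≤ M) : S.card ≤ 2 * M := by
  rw [← Finset.card_filter_add_card_filter_not (s := S) (fun v => u.1 < v.1), two_mul]
  refine Nat.add_le_add ?_ ?_
  · by_cases hne : (S.filter fun v => u.1 < v.1).Nonempty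
    · obtain ⟨v₀, hv₀⟩ := hne
      rw [Finset.mem_filter] at hv₀
      refine le_trans (Finset.card_le_card fun v hv => ?_) (h v₀ hv₀.1)
      rw [Finset.mem_filter] at hv ⊢
      exact ⟨hv.1, by simp [hv.2, hv₀.2]⟩
    · rw [Finset.not_nonempty_iff_eq_empty] at hne
      simp [hne]
  · by_cases hne : (S.filter fun v => ¬ u.1 < v.1).Nonempty
    · obtain ⟨v₀, hv₀⟩ := hne
      rw [Finset.mem_filter] at hv₀
      refine le_trans (Finset.card_le_card fun v hv => ?_) (h v₀ hv₀.1)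
      rw [Finset.mem_filter] at hv ⊢
      exact ⟨hv.1, by simp only [hv.2, hv₀.2]⟩
    · rw [Finset.not_nonempty_iff_eq_empty] at hne
      rw [hne]
      exact Nat.zero_le _

/-- Moving nodes of one clique to the same layers of another clique. -/
theorem card_clique_le {u u' : Fin N × Fin k} (S S' : Finset (Fin N × Fin k))
    (hS : ∀ w ∈ S, cliqueDist u w = 0) (h : ∀ w ∈ S, (u'.1, w.2) ∈ S') : S.card ≤ S'.card := by
  refine Finset.card_le_card_of_injOn (fun w => (u'.1, w.2)) h ?_
  intro w hw w' hw' hww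
  have h1 := hS w hw
  have h2 := hS w' hw'
  refine eq_of_cliqueDist_eq_zero ?_ (Prod.mk.inj hww).2
  unfold cliqueDist at *
  omega

end Geometry

/-! ### The invariants, and the ranking phase as a map between them. -/

section Invariants

variable {n k : ℕ}

/-- The messages that are offered for sending in a ranking phase. -/
def NodeState.offered {V : Type*} [DecidableEq V] (s : NodeState V) : Finset V :=
  s.unsent \ s.deferred

theorem NodeState.mem_offered {V : Type*} [DecidableEq V] {s : NodeState V} {v : V} :
    v ∈ s.offered ↔ (v ∈ s.received ∧ v ∉ s.sent) ∧ v ∉ s.deferred := by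
  simp [NodeState.offered, NodeState.unsent]

theorem NodeState.mem_fresh {V : Type*} {p : Params} {s : NodeState V} {v : V} :
    v ∈ s.fresh p ↔ v ∈ s.received ∧ 2 * s.cnt v < p.tau := by
  unfold NodeState.fresh Params.threshold
  rw [Finset.mem_filter, lt_div_iff₀ two_pos, mul_comm]
  norm_cast

open Classical in
/-- The global states with which ranking phase number `r` (from `0`) starts, if all goes well. -/
structure RankingStart (p : Params) (r : ℕ) (σ : Fin (n / k) × Fin k → NodeState _) : Prop where
  known : ∀ u v, cliqueDist u v ≤ r → v ∈ (σ u).received ∧ p.tau ≤ 2 * (σ u).cnt v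
  -- Among the nodes of a clique ahead of the wave, only one can have sent a given message. This
  -- keeps the counters of far messages at three or less.
  sent_layer : ∀ u v, r + 1 ≤ cliqueDist u v → v ∈ (σ u).sent → v.2 = u.2
  cnt_le : ∀ u v, r + 2 ≤ cliqueDist u v → (σ u).cnt v
    ≤ (Finset.univ.filter fun w => (cliquePath n k).Adj u w ∧ v ∈ (σ w).sent).card
  -- The exception is a leftover of the random phase, not yet removed by any filter.
  offered_near : ∀ u v, v ∈ (σ u).offered →
    cliqueDist u v ≤ r + 1 ∨ r = 0 ∧ cliqueDist u v = 2 ∧ v.2 = u.2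
  -- Strays from before the first shuffle phase, which stay ahead of the wave only while `r ≤ 1`.
  received_far : ∀ u v, v ∈ (σ u).received → r + 2 ≤ cliqueDist u v →
    r ≤ 1 ∧ cliqueDist u v = r + 2 ∧ v.2 = u.2
  -- These are all the far messages that `u` may know after the coming ranking phase. The bound `8τ`
  -- is the length of the shuffle phase that has to empty the buffers.
  buffer_bound : ∀ u, (Finset.univ.filter fun v => r + 2 ≤ cliqueDist u v ∧
    (v ∈ (σ u).received ∨ ∃ w, (cliquePath n k).Adj u w ∧ v ∈ (σ w).offered)).card ≤ 8 * p.tau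
  -- `τ/2 + 2` holders here become `τ/2 + 1` in `ShuffleStart`: the transfer along the matching
  -- loses at most one, on the layer of `v`. The rank bound covers every way of breaking ties.
  holders : ∀ u v, cliqueDist u v = r + 1 → p.tau + 4 ≤ 2 * (Finset.univ.filter fun w =>
    cliqueDist u w = 0 ∧ v ∈ (σ w).offered ∧
      ∀ tie, (σ w).rank tie (σ w).offered v ≤ 8 * p.tau).card

open Classical in
/-- The global states with which shuffle phase number `r` (from `0`) starts, if all goes well. -/
structure ShuffleStart (p : Params) (r : ℕ) (σ : Fin (n / k) × Fin k → NodeState _) : Prop where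
  known : ∀ u v, cliqueDist u v ≤ r + 1 → v ∈ (σ u).received ∧ p.tau ≤ 2 * (σ u).cnt v
  sent_layer : ∀ u v, r + 2 ≤ cliqueDist u v → v ∈ (σ u).sent → v.2 = u.2
  cnt_le : ∀ u v, r + 2 ≤ cliqueDist u v → (σ u).cnt v
    ≤ (Finset.univ.filter fun w => (cliquePath n k).Adj u w ∧ v ∈ (σ w).sent).card
  received_far : ∀ u v, v ∈ (σ u).received → r + 3 ≤ cliqueDist u v →
    r = 0 ∧ cliqueDist u v = 3 ∧ v.2 = u.2
  buffer_bound : ∀ u, ((σ u).fresh p ∩ (σ u).unsent).card ≤ 8 * p.tau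
  holders : ∀ u v, cliqueDist u v = r + 2 → p.tau + 2 ≤ 2 * (Finset.univ.filter fun w =>
    cliqueDist u w = 0 ∧ v ∈ (σ w).fresh p ∩ (σ w).unsent).card

/-- The two matching neighbours of `u`, and the node of its clique on the layer of `v`. -/
theorem card_adj_le_three {u v : Fin (n / k) × Fin k} (S : Finset (Fin (n / k) × Fin k))
    (hS : ∀ w ∈ S, (cliquePath n k).Adj u w ∧ (cliqueDist u w = 0 → w.2 = v.2)) :
    S.card ≤ 3 := by
  refine card_le_three u v.2 _ fun w hw => ?_
  obtain ⟨h1, h2⟩ := hS w hw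
  rcases cliquePath_adj.1 h1 with h1 | h1
  · exact .inr h1
  · exact .inl ⟨h1.1, h2 h1.1⟩

theorem ShuffleStart.cnt_le_three {p : Params} {r : ℕ} {σ : Fin (n / k) × Fin k → NodeState _}
    (h : ShuffleStart p r σ) {u v : Fin (n / k) × Fin k} (huv : r + 2 ≤ cliqueDist u v) :
    (σ u).cnt v ≤ 3 := by
  classical
  refine (h.cnt_le u v huv).trans (card_adj_le_three (u := u) (v := v) _ fun w hw => ?_)
  simp only [Finset.mem_filter, Finset.mem_univ, true_and] at hw
  refine ⟨hw.1, fun hd => ?_⟩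
  refine (h.sent_layer w v ?_ hw.2).symm
  unfold cliqueDist at *
  omega

theorem exists_towards {N k : ℕ} {u v : Fin N × Fin k} {r : ℕ} (h : cliqueDist u v = r + 1) :
    ∃ u' : Fin N × Fin k, cliqueDist u u' = 1 ∧ u'.2 = u.2 ∧ cliqueDist u' v = r := by
  unfold cliqueDist at *
  have h1 := u.1.isLt
  have h2 := v.1.isLt
  by_cases hlt : u.1.val < v.1.val
  · exact ⟨(⟨u.1.val + 1, by omega⟩, u.2), by simp, rfl, by simp only; omega⟩
  · exact ⟨(⟨u.1.val - 1, by omega⟩, u.2), by simp only; omega, rfl, by simp only; omega⟩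

/-- A ranking phase in which all messages of small rank are sent. -/
theorem RankingStart.shuffleStart {p : Params} {r : ℕ} {σ σ' : Fin (n / k) × Fin k → NodeState _}
    (hτ : 6 < p.tau) (h : RankingStart p r σ) (tie : Fin (n / k) × Fin k → (_ ↪ ℕ))
    (hrel : PopRel (cliquePath n k) (fun u => (σ u).prepare p (tie u) (.ranking 0)) σ')
    (hsend : ∀ u v, v ∈ (σ u).offered → (∀ tie, (σ u).rank tie (σ u).offered v ≤ 8 * p.tau) →
      v ∈ (σ' u).sent) : ShuffleStart p r σ' := by
  classical
  have hsent_of : ∀ u v, v ∈ (σ' u).sent → v ∈ (σ u).sent ∨ v = u ∨ v ∈ (σ u).offered :=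
    hrel.sent_of
  have hsent_mono : ∀ u, (σ u).sent ⊆ (σ' u).sent := hrel.sent_mono
  have hrec_mono : ∀ u, (σ u).received ⊆ (σ' u).received := hrel.received_mono
  have hrec_of : ∀ u v, v ∈ (σ' u).received → v ∈ (σ u).received ∨
    ∃ w, (cliquePath n k).Adj u w ∧ (v = w ∨ v ∈ (σ' w).sent ∧ v ∉ (σ w).sent) :=
    hrel.received_of
  have hrec_new : ∀ u w v, (cliquePath n k).Adj u w → v ∈ (σ' w).sent → v ∉ (σ w).sent →
    v ∈ (σ' u).received := hrel.received_new
  have hcnt_ge : ∀ u v, (σ u).cnt v + (Finset.univ.filter fun w =>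
    (cliquePath n k).Adj u w ∧ v ∈ (σ' w).sent ∧ v ∉ (σ w).sent).card ≤ (σ' u).cnt v :=
    hrel.cnt_ge
  have hcnt_eq : ∀ u v, ¬ (cliquePath n k).Adj u v → (σ' u).cnt v = (σ u).cnt v
    + (Finset.univ.filter fun w =>
      (cliquePath n k).Adj u w ∧ v ∈ (σ' w).sent ∧ v ∉ (σ w).sent).card := hrel.cnt_eq
  have hsent_layer : ∀ u v, r + 2 ≤ cliqueDist u v → v ∈ (σ' u).sent → v.2 = u.2 := by
    intro u v huv hv
    rcases hsent_of u v hv with h1 | h1 | h1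
    · exact h.sent_layer u v (by omega) h1
    · rw [h1]
    · rcases h.offered_near u v h1 with h2 | h2
      · omega
      · exact h2.2.2
  have hcnt_le : ∀ u v, r + 2 ≤ cliqueDist u v → (σ' u).cnt v
      ≤ (Finset.univ.filter fun w => (cliquePath n k).Adj u w ∧ v ∈ (σ' w).sent).card := by
    intro u v huv
    have hadj : ¬ (cliquePath n k).Adj u v := fun h1 => by
      have := cliqueDist_le_one_of_adj h1
      omega
    rw [hcnt_eq u v hadj]
    have h1 := h.cnt_le u v huv
    have h2 : (Finset.univ.filter fun w =>
        (cliquePath n k).Adj u w ∧ v ∈ (σ w).sent).card + (Finset.univ.filter fun w =>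
        (cliquePath n k).Adj u w ∧ v ∈ (σ' w).sent ∧ v ∉ (σ w).sent).card
        ≤ (Finset.univ.filter fun w => (cliquePath n k).Adj u w ∧ v ∈ (σ' w).sent).card := by
      rw [← Finset.card_union_of_disjoint]
      · refine Finset.card_le_card fun w => ?_
        have := @hsent_mono w v
        simp only [Finset.mem_filter, Finset.mem_univ, true_and, Finset.mem_union]
        tauto
      · rw [Finset.disjoint_left]
        intro w
        simp only [Finset.mem_filter, Finset.mem_univ, true_and]
        tauto
    omega
  have hcnt3 : ∀ u v, r + 2 ≤ cliqueDist u v → (σ' u).cnt v ≤ 3 := by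
    intro u v huv
    refine (hcnt_le u v huv).trans (card_adj_le_three (u := u) (v := v) _ fun w hw => ?_)
    simp only [Finset.mem_filter, Finset.mem_univ, true_and] at hw
    refine ⟨hw.1, fun hd => ?_⟩
    refine (hsent_layer w v ?_ hw.2).symm
    unfold cliqueDist at *
    omega
  have hknown : ∀ u v, cliqueDist u v ≤ r + 1 →
      v ∈ (σ' u).received ∧ p.tau ≤ 2 * (σ' u).cnt v := by
    intro u v huv
    by_cases hr : cliqueDist u v ≤ r
    · obtain ⟨h1, h2⟩ := h.known u v hr
      have := hcnt_ge u v
      exact ⟨hrec_mono u h1, by omega⟩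
    -- Distance `r + 1`: all holders in the clique of `u` send the message, and `u` hears each of
    -- them except itself.
    · have hH := h.holders u v (by omega)
      set H := Finset.univ.filter fun w => cliqueDist u w = 0 ∧ v ∈ (σ w).offered ∧
        ∀ tie, (σ w).rank tie (σ w).offered v ≤ 8 * p.tau with hHdef
      have hHe : H.card - 1 ≤ (H.erase u).card := Finset.pred_card_le_card_erase
      have hsub : H.erase u ⊆ Finset.univ.filter fun w =>
          (cliquePath n k).Adj u w ∧ v ∈ (σ' w).sent ∧ v ∉ (σ w).sent := by
        intro w hw
        simp only [hHdef, Finset.mem_erase, Finset.mem_filter, Finset.mem_univ, true_and] at hw ⊢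
        obtain ⟨hne, hd, h1, h2⟩ := hw
        refine ⟨cliquePath_adj.2 (.inr ⟨hd, fun he => hne ?_⟩), hsend w v h1 h2,
          (NodeState.mem_offered.1 h1).1.2⟩
        exact (eq_of_cliqueDist_eq_zero hd he.symm).symm
      have hcard := Finset.card_le_card hsub
      have h1 := hcnt_ge u v
      refine ⟨?_, by omega⟩
      obtain ⟨w, hw⟩ : (H.erase u).Nonempty := Finset.card_pos.1 (by omega)
      have h2 := hsub hw
      simp only [Finset.mem_filter, Finset.mem_univ, true_and] at h2
      exact hrec_new u w v h2.1 h2.2.1 h2.2.2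
  refine ⟨hknown, hsent_layer, hcnt_le, ?_, ?_, ?_⟩
  · intro u v hv huv
    rcases hrec_of u v hv with h1 | ⟨w, hw, h1 | ⟨h1, h2⟩⟩
    · have := h.received_far u v h1 (by omega)
      omega
    · have := cliqueDist_le_one_of_adj hw
      rw [h1] at huv
      omega
    · rcases hsent_of w v h1 with h3 | h3 | h3
      · exact absurd h3 h2
      · have := cliqueDist_le_one_of_adj hw
        rw [h3] at huv
        omega
      · have hd := h.offered_near w v h3
        rcases cliquePath_adj.1 hw with ⟨h4, h5⟩ | ⟨h4, h5⟩
        · rw [← h5]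
          unfold cliqueDist at *
          omega
        · unfold cliqueDist at *
          omega
  · intro u
    refine (Finset.card_le_card fun v hv => ?_).trans (h.buffer_bound u)
    rw [Finset.mem_inter, NodeState.mem_fresh] at hv
    have hfar : r + 2 ≤ cliqueDist u v := by
      by_contra hlt
      have := (hknown u v (by omega)).2
      omega
    simp only [Finset.mem_filter, Finset.mem_univ, true_and]
    refine ⟨hfar, ?_⟩
    rcases hrec_of u v hv.1.1 with h1 | ⟨w, hw, h1 | ⟨h1, h2⟩⟩
    · exact .inl h1
    · have := cliqueDist_le_one_of_adj hw
      rw [h1] at hfar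
      omega
    · rcases hsent_of w v h1 with h3 | h3 | h3
      · exact absurd h3 h2
      · have := cliqueDist_le_one_of_adj hw
        rw [h3] at hfar
        omega
      · exact .inr ⟨w, hw, h3⟩
  · intro u v huv
    -- Distance `r + 2`: the holders sit one clique nearer to `v` and send along the matching. The
    -- one on the layer of `v` is dropped, since its partner may already have sent the message.
    obtain ⟨u', hu1, hu2, hu3⟩ := exists_towards huv
    have hH := h.holders u' v hu3
    set H := Finset.univ.filter fun w => cliqueDist u' w = 0 ∧ v ∈ (σ w).offered ∧
      ∀ tie, (σ w).rank tie (σ w).offered v ≤ 8 * p.tau with hHdef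
    have hHe : H.card - 1 ≤ (H.erase (u'.1, v.2)).card := Finset.pred_card_le_card_erase
    have hle : (H.erase (u'.1, v.2)).card ≤ (Finset.univ.filter fun w =>
        cliqueDist u w = 0 ∧ v ∈ (σ' w).fresh p ∩ (σ' w).unsent).card := by
      refine card_clique_le (u := u') (u' := u) _ _ (fun w hw => ?_) fun w hw => ?_
      · simp only [hHdef, Finset.mem_erase, Finset.mem_filter, Finset.mem_univ, true_and] at hw
        exact hw.2.1
      · simp only [hHdef, Finset.mem_erase, Finset.mem_filter, Finset.mem_univ, true_and] at hw
        obtain ⟨hne, hd, h1, h2⟩ := hw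
        have hlayer : v.2 ≠ w.2 := by
          intro he
          refine hne ((eq_of_cliqueDist_eq_zero ?_ ?_).symm)
          · unfold cliqueDist at *
            simpa using hd
          · exact he
        have hfar : r + 2 ≤ cliqueDist (u.1, w.2) v := huv.ge
        have hrec : v ∈ (σ' (u.1, w.2)).received := by
          refine hrec_new _ w v (cliquePath_adj.2 (.inl ⟨?_, rfl⟩)) (hsend w v h1 h2)
            (NodeState.mem_offered.1 h1).1.2
          unfold cliqueDist at *
          simp only
          omega
        have h3 := hcnt3 _ v hfar
        simp only [Finset.mem_filter, Finset.mem_univ, true_and, Finset.mem_inter,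
          NodeState.mem_fresh, NodeState.unsent, Finset.mem_sdiff]
        exact ⟨by simp [cliqueDist], ⟨hrec, by omega⟩, hrec,
          fun h4 => hlayer (hsent_layer (u.1, w.2) v hfar h4)⟩
    omega

end Invariants

/-! ### The shuffle phase as a map between the invariants. -/

section Invariants

variable {n k : ℕ}

/-- Nearer messages are no longer fresh, farther ones are counted at most four times, and those at
distance `r + 2` are counted once for each of the more than `τ/2` holders in the clique. The result
depends on the clique of `u` only, which is what makes the selections balanced. -/
theorem ShuffleStart.candidates_eq {p : Params} {r : ℕ}
    {σ σ' : Fin (n / k) × Fin k → NodeState _} (hτ : 6 < p.tau) (hc : p.cHat ≤ 1 / 2)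
    (hc' : 4 < p.cHat * p.threshold) (h : ShuffleStart p r σ)
    (hrel : ShuffleRel (cliquePath n k) (fun u => (σ u).fresh p ∩ (σ u).unsent) σ (8 * p.tau) σ')
    (u : Fin (n / k) × Fin k) :
    (σ' u).candidates p = Finset.univ.filter fun v => cliqueDist u v = r + 2 := by
  classical
  have hbuf : ∀ w, (σ' w).buffer = ∅ := by
    intro w
    have h1 := hrel.buffer_card w
    have h2 := h.buffer_bound w
    rw [← Finset.card_eq_zero]
    omega
  ext v
  unfold NodeState.candidates
  simp only [Finset.mem_filter, Finset.mem_univ, true_and]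
  rw [hrel.cnt_eq u]
  constructor
  · rintro ⟨-, h1, h2⟩
    have hlo : r + 2 ≤ cliqueDist u v := by
      by_contra hlt
      have h3 := (h.known u v (by omega)).2
      have h4 : (p.tau : ℝ) ≤ 2 * (σ u).cnt v := by exact_mod_cast h3
      unfold Params.threshold at h2
      linarith
    by_contra hne
    have hfar : r + 3 ≤ cliqueDist u v := by omega
    have hadj : ¬ (cliquePath n k).Adj u v := fun h1 => by
      have := cliqueDist_le_one_of_adj h1
      omega
    have h3 := hrel.phasecnt_eq u v hadj
    have h4 : (Finset.univ.filter fun w => (cliquePath n k).Adj u w ∧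
        v ∈ (σ w).fresh p ∩ (σ w).unsent ∧ v ∉ (σ' w).buffer).card ≤ 3 := by
      refine card_adj_le_three (u := u) (v := v) _ fun w hw => ?_
      simp only [Finset.mem_filter, Finset.mem_univ, true_and] at hw
      refine ⟨hw.1, fun hd => ?_⟩
      have h5 := (NodeState.mem_fresh.1 (Finset.mem_inter.1 hw.2.1).1).1
      refine ((h.received_far w v h5 ?_).2.2).symm
      unfold cliqueDist at *
      omega
    -- One for holding the message at the start, and three receptions.
    have h5 : (σ' u).phasecnt v ≤ 4 := by
      rw [h3]
      refine (Nat.add_le_add_left h4 _).trans ?_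
      split_ifs <;> omega
    have h6 : ((σ' u).phasecnt v : ℝ) ≤ 4 := by exact_mod_cast h5
    linarith
  · intro hd
    have h1 := hrel.phasecnt_ge u v
    have h2 := h.holders u v hd
    have h3 : (Finset.univ.filter fun w =>
        cliqueDist u w = 0 ∧ v ∈ (σ w).fresh p ∩ (σ w).unsent).card ≤
        (if v ∈ (σ u).fresh p ∩ (σ u).unsent then 1 else 0) +
        (Finset.univ.filter fun w => (cliquePath n k).Adj u w ∧
          v ∈ (σ w).fresh p ∩ (σ w).unsent ∧ v ∉ (σ' w).buffer).card := by
      have hsub : (Finset.univ.filter fun w =>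
          cliqueDist u w = 0 ∧ v ∈ (σ w).fresh p ∩ (σ w).unsent) ⊆
          (if v ∈ (σ u).fresh p ∩ (σ u).unsent then {u} else ∅) ∪
          (Finset.univ.filter fun w => (cliquePath n k).Adj u w ∧
            v ∈ (σ w).fresh p ∩ (σ w).unsent ∧ v ∉ (σ' w).buffer) := by
        intro w hw
        rw [Finset.mem_filter] at hw
        obtain ⟨-, hw1, hw2⟩ := hw
        rw [Finset.mem_union]
        by_cases hwu : w = u
        · left
          subst hwu
          rw [if_pos hw2]
          exact Finset.mem_singleton_self _
        · right
          rw [Finset.mem_filter, hbuf]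
          refine ⟨Finset.mem_univ _, cliquePath_adj.2 (.inr ⟨hw1, fun he => hwu ?_⟩), hw2,
            Finset.notMem_empty _⟩
          exact (eq_of_cliqueDist_eq_zero hw1 he.symm).symm
      refine (Finset.card_le_card hsub).trans ((Finset.card_union_le _ _).trans ?_)
      refine Nat.add_le_add_right ?_ _
      split_ifs <;> simp
    have h4 : p.tau + 2 ≤ 2 * (σ' u).phasecnt v := by
      refine h2.trans (Nat.mul_le_mul_left 2 (h3.trans ?_))
      exact h1
    have h5 : (p.tau : ℝ) + 2 ≤ 2 * (σ' u).phasecnt v := by exact_mod_cast h4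
    have h6 := h.cnt_le_three hd.ge
    have h7 : ((σ u).cnt v : ℝ) ≤ 3 := by exact_mod_cast h6
    have h8 : (6 : ℝ) < p.tau := by exact_mod_cast hτ
    refine ⟨by omega, ?_, ?_⟩
    · unfold Params.threshold
      have : p.cHat * (p.tau / 2) ≤ 1 / 2 * (p.tau / 2) := by gcongr
      linarith
    · unfold Params.threshold
      linarith

/-- The first component of the key lets only selected messages precede a selected one. -/
theorem NodeState.rank_le_of_mem_selected {V : Type*} [Fintype V] [DecidableEq V]
    {s : NodeState V} {tie : V ↪ ℕ} {B : Finset V} {v : V} (hv : v ∈ s.selected) :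
    s.rank tie B v ≤ s.selected.card := by
  classical
  refine Finset.card_le_card fun w hw => ?_
  rw [Finset.mem_filter] at hw
  by_contra hws
  have h1 := hw.2
  unfold NodeState.sortKey at h1
  rw [if_neg hws, if_pos hv, Prod.Lex.toLex_le_toLex] at h1
  simp at h1

/-- A shuffle phase with a balanced selection. -/
theorem ShuffleStart.rankingStart {p : Params} {r : ℕ}
    {σ σ' : Fin (n / k) × Fin k → NodeState _} (hτ : 6 < p.tau) (h : ShuffleStart p r σ)
    (hrel : ShuffleRel (cliquePath n k) (fun u => (σ u).fresh p ∩ (σ u).unsent) σ (8 * p.tau) σ')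
    (hcand : ∀ u, (σ' u).candidates p = Finset.univ.filter fun v => cliqueDist u v = r + 2)
    (A : Fin (n / k) × Fin k → Finset (Fin (n / k) × Fin k))
    (hA : ∀ u, A u ⊆ (σ' u).candidates p) (hA' : ∀ u, (A u).card ≤ 4 * p.tau)
    (hmany : ∀ u v, cliqueDist u v = r + 2 →
      p.tau + 6 ≤ 2 * (Finset.univ.filter fun w => cliqueDist u w = 0 ∧ v ∈ A w).card)
    (hboth : ∀ u v v', cliqueDist u v = r + 2 → cliqueDist u v' = r + 2 → v.1 ≠ v'.1 →
      ¬ ∀ w ∈ A u, w.1 = v.1) :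
    RankingStart p (r + 1) fun u => (σ' u).finishShuffle p (A u) := by
  classical
  set ρ : Fin (n / k) × Fin k → NodeState _ := fun u => (σ' u).finishShuffle p (A u) with hρ
  have hrec : ∀ u v, v ∈ (ρ u).received ↔ v ∈ (σ u).received ∨ cliqueDist u v = r + 2 := by
    intro u v
    show v ∈ (σ' u).received ∪ (σ' u).candidates p ↔ _
    rw [hcand, hrel.received_eq]
    simp
  have hsent : ∀ u, (ρ u).sent = (σ u).sent := hrel.sent_eq
  have hcnt : ∀ u, (ρ u).cnt = (σ u).cnt := hrel.cnt_eq
  have hdef : ∀ u v, v ∈ (ρ u).deferred ↔ v ∈ (ρ u).fresh p ∧ v ∉ A u := by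
    intro u v
    show v ∈ _ \ A u ↔ _
    rw [Finset.mem_sdiff]
    rfl
  have hAd : ∀ u v, v ∈ A u → cliqueDist u v = r + 2 := by
    intro u v hv
    have := hA u hv
    rw [hcand] at this
    simpa using this
  -- A far message has `cnt ≤ 3`, so it is fresh, and deferred unless selected.
  have hoff : ∀ u v, v ∈ (ρ u).offered → r + 2 ≤ cliqueDist u v → v ∈ A u := by
    intro u v hv hd
    rw [NodeState.mem_offered, hdef, NodeState.mem_fresh, hcnt] at hv
    by_contra hva
    have := h.cnt_le_three hd
    exact hv.2 ⟨⟨hv.1.1, by omega⟩, hva⟩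
  have hnear : ∀ u v, v ∈ (ρ u).offered → cliqueDist u v ≤ r + 2 := by
    intro u v hv
    by_contra hd
    have := hAd u v (hoff u v hv (by omega))
    omega
  refine ⟨?_, ?_, ?_, ?_, ?_, ?_, ?_⟩
  · intro u v huv
    obtain ⟨h1, h2⟩ := h.known u v huv
    rw [hrec, hcnt]
    exact ⟨.inl h1, h2⟩
  · intro u v huv
    rw [hsent]
    exact h.sent_layer u v huv
  · intro u v huv
    simp only [hsent, hcnt]
    exact h.cnt_le u v (by omega)
  · intro u v hv
    exact .inl (hnear u v hv)
  · intro u v hv huv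
    rcases (hrec u v).1 hv with h1 | h1
    · have := h.received_far u v h1 huv
      exact ⟨by omega, by omega, this.2.2⟩
    · omega
  · intro u
    set S := Finset.univ.filter fun v => r + 1 + 2 ≤ cliqueDist u v ∧
      (v ∈ (ρ u).received ∨ ∃ w, (cliquePath n k).Adj u w ∧ v ∈ (ρ w).offered) with hS
    have hSd : ∀ v ∈ S, cliqueDist u v = r + 3 ∧ (v.2 = u.2 ∨
        ∃ w, cliqueDist u w = 1 ∧ w.2 = u.2 ∧ cliqueDist w v = r + 2 ∧ v ∈ A w) := by
      intro v hv
      simp only [hS, Finset.mem_filter, Finset.mem_univ, true_and] at hv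
      obtain ⟨hd, hv | ⟨w, hw, hv⟩⟩ := hv
      · rcases (hrec u v).1 hv with h1 | h1
        · have := h.received_far u v h1 hd
          exact ⟨by omega, .inl this.2.2⟩
        · omega
      · have hdw := hnear w v hv
        rcases cliquePath_adj.1 hw with ⟨h1, h2⟩ | ⟨h1, h2⟩
        · have h3 : cliqueDist w v = r + 2 ∧ cliqueDist u v = r + 3 := by
            unfold cliqueDist at *
            omega
          exact ⟨h3.2, .inr ⟨w, h1, h2, h3.1, hoff w v hv h3.1.ge⟩⟩
        · unfold cliqueDist at *
          omega
    -- On either side of `u` there are the selections of one matching neighbour `w` and at most one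
    -- stray on the layer of `u`. If both sides occur, `4τ + 1` twice is too much, but then `hboth`
    -- puts part of the selection of `w` on its other side.
    have hone : ∀ v₀ ∈ S, (S.filter fun v => v.1 = v₀.1).card ≤ 4 * p.tau + 1 ∧
        ((∃ v₁ ∈ S, v₁.1 ≠ v₀.1) → (S.filter fun v => v.1 = v₀.1).card ≤ 4 * p.tau) := by
      intro v₀ hv₀
      obtain ⟨hd₀, -⟩ := hSd v₀ hv₀
      obtain ⟨w, hw1, hw2, hw3⟩ := exists_towards hd₀
      have hsub : (S.filter fun v => v.1 = v₀.1) ⊆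
          insert (v₀.1, u.2) ((A w).filter fun v => v.1 = v₀.1) := by
        intro v hv
        rw [Finset.mem_filter] at hv
        obtain ⟨hvS, hv1⟩ := hv
        obtain ⟨hd, h1 | ⟨w', h1, h2, h3, h4⟩⟩ := hSd v hvS
        · refine Finset.mem_insert.2 (.inl (Prod.ext hv1 h1))
        · refine Finset.mem_insert_of_mem (Finset.mem_filter.2 ⟨?_, hv1⟩)
          have : w' = w := by
            refine eq_of_cliqueDist_eq_zero ?_ (h2.trans hw2.symm)
            rw [Fin.ext_iff] at hv1
            unfold cliqueDist at *
            omega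
          rwa [← this]
      have hcard := (Finset.card_le_card hsub).trans (Finset.card_insert_le _ _)
      have hfil : ((A w).filter fun v => v.1 = v₀.1).card ≤ (A w).card :=
        Finset.card_filter_le _ _
      have hAw := hA' w
      refine ⟨by omega, ?_⟩
      rintro ⟨v₁, hv₁, hne⟩
      obtain ⟨hd₁, -⟩ := hSd v₁ hv₁
      have hb := hboth w v₀
      -- The path reaches `v₁` at distance `r + 3` on the other side of `u`, so `w` also has
      -- candidates there.
      have hex : ∃ v', cliqueDist w v' = r + 2 ∧ v₀.1 ≠ v'.1 := by
        have hne' : v₁.1.val ≠ v₀.1.val := fun he => hne (Fin.ext he)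
        have l1 := v₁.1.isLt
        have l0 := v₀.1.isLt
        have lw := w.1.isLt
        by_cases hlt : v₀.1.val < w.1.val
        · refine ⟨(⟨w.1.val + (r + 2), ?_⟩, w.2), ?_, ?_⟩
          · unfold cliqueDist at *
            omega
          · simp [cliqueDist]
          · intro he
            have := congrArg Fin.val he
            simp only at this
            omega
        · refine ⟨(⟨w.1.val - (r + 2), ?_⟩, w.2), ?_, ?_⟩
          · omega
          · unfold cliqueDist at *
            simp only
            omega
          · intro he
            have := congrArg Fin.val he
            simp only at this
            unfold cliqueDist at *
            omega
      obtain ⟨v', hv'1, hv'2⟩ := hex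
      have hnot := hb v' hw3 hv'1 hv'2
      push Not at hnot
      obtain ⟨x, hx, hxne⟩ := hnot
      have hlt : ((A w).filter fun v => v.1 = v₀.1).card < (A w).card := by
        refine Finset.card_lt_card (Finset.filter_ssubset.2 ⟨x, hx, hxne⟩)
      omega
    by_cases hne : S.Nonempty
    · obtain ⟨v₀, hv₀⟩ := hne
      by_cases hex : ∃ v₁ ∈ S, v₁.1 ≠ v₀.1
      · have h0 := (hone v₀ hv₀).2 hex
        obtain ⟨v₁, hv₁, hne⟩ := hex
        have h1 := (hone v₁ hv₁).2 ⟨v₀, hv₀, hne.symm⟩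
        rw [← Finset.card_filter_add_card_filter_not (s := S) (fun v => v.1 = v₀.1)]
        have h2 : (S.filter fun v => ¬ v.1 = v₀.1) ⊆ S.filter fun v => v.1 = v₁.1 := by
          intro v hv
          rw [Finset.mem_filter] at hv ⊢
          refine ⟨hv.1, Fin.ext ?_⟩
          have e0 := (hSd v₀ hv₀).1
          have e1 := (hSd v₁ hv₁).1
          have e2 := (hSd v hv.1).1
          have n1 : v₁.1.val ≠ v₀.1.val := fun he => hne (Fin.ext he)
          have n2 : v.1.val ≠ v₀.1.val := fun he => hv.2 (Fin.ext he)
          unfold cliqueDist at *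
          omega
        have h3 := Finset.card_le_card h2
        omega
      · push Not at hex
        have h0 := (hone v₀ hv₀).1
        rw [Finset.filter_true_of_mem hex] at h0
        omega
    · rw [Finset.not_nonempty_iff_eq_empty] at hne
      rw [hne]
      exact Nat.zero_le _
  · intro u v huv
    have hm := hmany u v huv
    set H := Finset.univ.filter fun w => cliqueDist u w = 0 ∧ v ∈ A w with hH
    -- Only the node on the layer of `v` can have sent the message before, by `sent_layer`; the
    -- other selectors offer it.
    have hHe : H.card - 1 ≤ (H.erase (u.1, v.2)).card := Finset.pred_card_le_card_erase
    have hle : (H.erase (u.1, v.2)).card ≤ (Finset.univ.filter fun w =>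
        cliqueDist u w = 0 ∧ v ∈ (ρ w).offered ∧
          ∀ tie, (ρ w).rank tie (ρ w).offered v ≤ 8 * p.tau).card := by
      refine Finset.card_le_card fun w hw => ?_
      simp only [hH, Finset.mem_erase, Finset.mem_filter, Finset.mem_univ, true_and] at hw ⊢
      obtain ⟨hne, hd, hv⟩ := hw
      have hdw : cliqueDist w v = r + 2 := hAd w v hv
      refine ⟨hd, ?_, fun tie => ?_⟩
      · rw [NodeState.mem_offered, hdef, hsent, hrec]
        refine ⟨⟨.inr hdw, fun hs => hne ?_⟩, fun hdf => hdf.2 hv⟩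
        have := h.sent_layer w v hdw.ge hs
        refine (eq_of_cliqueDist_eq_zero (u := (u.1, v.2)) (v := w) ?_ this).symm
        unfold cliqueDist at *
        simpa using hd
      · refine (NodeState.rank_le_of_mem_selected (s := ρ w) (v := v) hv).trans ?_
        have := hA' w
        show (A w).card ≤ _
        omega
    have hle2 := Nat.mul_le_mul_left 2 hle
    omega

end Invariants

/-! ### The state after round `0`. -/

section Initial

variable {V : Type*} [Fintype V] [DecidableEq V]

/-- The global state after round `0`. -/
def afterInitial (G : SimpleGraph V) : V → NodeState V :=
  fun u => (NodeState.init u).deliver G id u .initial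

theorem execution_one (p : Params) (G : SimpleGraph V) (tie : TieRule V) :
    execution p G tie 1 = PMF.pure (afterInitial G) := by
  have h0 : p.stage 0 = .initial := by simp [Params.stage]
  show (PMF.pure NodeState.init).bind (step p G tie 0) = _
  rw [PMF.pure_bind]
  unfold step
  rw [h0]
  simp only [NodeState.messageLaw]
  rw [independent_pure, PMF.pure_bind]
  rfl

theorem afterInitial_received (G : SimpleGraph V) {u v : V} :
    v ∈ (afterInitial G u).received ↔ v = u ∨ G.Adj u v := by
  classical
  show v ∈ {u} ∪ Finset.univ.filter (fun v => 0 < receptions G id u v) ↔ _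
  simp only [Finset.mem_union, Finset.mem_singleton, Finset.mem_filter, Finset.mem_univ, true_and,
    receptions, id, Finset.card_pos]
  refine or_congr_right ⟨?_, fun h => ⟨v, by simp [h]⟩⟩
  rintro ⟨w, hw⟩
  simp only [Finset.mem_filter, Finset.mem_univ, true_and] at hw
  exact hw.2 ▸ hw.1

theorem afterInitial_sent (G : SimpleGraph V) (u : V) : (afterInitial G u).sent = {u} := rfl

theorem afterInitial_cnt (G : SimpleGraph V) [DecidableRel G.Adj] (u v : V) :
    (afterInitial G u).cnt v = if v = u ∨ G.Adj u v then 1 else 0 := by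
  classical
  show (if v = u then 1 else 0) + receptions G id u v = _
  have h1 : receptions G id u v = if G.Adj u v then 1 else 0 := by
    unfold receptions
    split_ifs with h
    · rw [Finset.card_eq_one]
      refine ⟨v, ?_⟩
      ext w
      simp only [Finset.mem_filter, Finset.mem_univ, true_and, Finset.mem_singleton, id]
      exact ⟨fun hw => hw.2, fun hw => ⟨hw ▸ h, hw⟩⟩
    · rw [Finset.card_eq_zero]
      ext w
      simp only [Finset.mem_filter, Finset.mem_univ, true_and, id, Finset.notMem_empty, iff_false]
      rintro ⟨hw, rfl⟩
      exact h hw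
  rw [h1]
  by_cases hv : v = u
  · subst hv
    simp
  · simp [hv]

theorem afterInitial_unsent (G : SimpleGraph V) {u v : V} :
    v ∈ (afterInitial G u).unsent ↔ G.Adj u v := by
  rw [NodeState.unsent, Finset.mem_sdiff, afterInitial_received, afterInitial_sent,
    Finset.mem_singleton]
  constructor
  · tauto
  · intro h
    exact ⟨.inr h, h.ne'⟩

end Initial

/-! ### The random phase establishes the first invariant. -/

section RandomPhase

variable {n k : ℕ}

theorem NodeState.cnt_le_of_rank {V : Type*} [Fintype V] [DecidableEq V]
    {s : NodeState V} {tie : V ↪ ℕ} {v w : V} (hs : s.selected = ∅)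
    (h : s.sortKey tie w ≤ s.sortKey tie v) : s.cnt w ≤ s.cnt v := by
  unfold NodeState.sortKey at h
  rw [hs, if_neg (Finset.notMem_empty _), if_neg (Finset.notMem_empty _),
    Prod.Lex.toLex_le_toLex] at h
  simp only [lt_self_iff_false, true_and, false_or] at h
  rw [Prod.Lex.toLex_le_toLex] at h
  rcases h with h | h
  · exact h.le
  · exact h.1.le

/-- A random phase in which the messages are sent evenly. -/
theorem rankingStart_zero {p : Params} {σ' : Fin (n / k) × Fin k → NodeState _}
    (hτ : 6 < p.tau) (tie : Fin (n / k) × Fin k → (_ ↪ ℕ))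
    (hrel : PopRel (cliquePath n k)
      (fun u => (afterInitial (cliquePath n k) u).prepare p (tie u) (.random 0)) σ')
    (hcard : ∀ u, (σ' u).sent.card ≤ p.tau + 1)
    (hmany : ∀ v, p.tau + 6 ≤ 2 * (Finset.univ.filter fun x =>
      cliqueDist v x = 0 ∧ x ≠ v ∧ v ∈ (σ' x).sent).card)
    (hfew : ∀ u y, cliqueDist u y = 1 → 2 * (Finset.univ.filter fun x =>
      cliqueDist u x = 0 ∧ (y.1, x.2) ∈ (σ' x).sent).card ≤ 5 * p.tau) :
    RankingStart p 0 σ' := by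
  classical
  set G := cliquePath n k with hG
  have hsent_of : ∀ u v, v ∈ (σ' u).sent → v = u ∨ G.Adj u v := by
    intro u v hv
    rcases hrel.sent_of u v hv with h1 | h1 | h1
    · exact .inl (Finset.mem_singleton.1 h1)
    · exact .inl h1
    · exact .inr (afterInitial_unsent G |>.1 h1)
  have hrec_adj : ∀ u v, v = u ∨ G.Adj u v → v ∈ (σ' u).received := fun u v h =>
    hrel.received_mono u ((afterInitial_received G).2 h)
  have hrec_of : ∀ u v, v ∈ (σ' u).received → v = u ∨ G.Adj u v ∨
      ∃ w, G.Adj u w ∧ G.Adj w v ∧ v ∈ (σ' w).sent := by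
    intro u v hv
    rcases hrel.received_of u v hv with h1 | ⟨w, hw, h1 | ⟨h1, h2⟩⟩
    · rcases (afterInitial_received G).1 h1 with h1 | h1
      · exact .inl h1
      · exact .inr (.inl h1)
    · exact .inr (.inl (h1 ▸ hw))
    · rcases hsent_of w v h1 with h3 | h3
      · exact .inr (.inl (h3 ▸ hw))
      · exact .inr (.inr ⟨w, hw, h3, h1⟩)
  have hrec_new : ∀ u w v, G.Adj u w → v ∈ (σ' w).sent → v ≠ w → v ∈ (σ' u).received :=
    fun u w v hw h1 h2 => hrel.received_new u w v hw h1 (fun h3 => h2 (Finset.mem_singleton.1 h3))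
  have hcnt_ge : ∀ u v, (if v = u ∨ G.Adj u v then 1 else 0) + (Finset.univ.filter fun w =>
      G.Adj u w ∧ v ∈ (σ' w).sent ∧ v ≠ w).card ≤ (σ' u).cnt v := by
    intro u v
    have h1 := hrel.cnt_ge u v
    refine le_trans ?_ h1
    refine Nat.add_le_add (afterInitial_cnt G u v).ge (Finset.card_le_card fun w hw => ?_)
    rw [Finset.mem_filter] at hw ⊢
    exact ⟨hw.1, hw.2.1, hw.2.2.1, fun h3 => hw.2.2.2 (Finset.mem_singleton.1 h3)⟩
  have hcnt_le : ∀ u v, v ≠ u → ¬ G.Adj u v → (σ' u).cnt v ≤ (Finset.univ.filter fun w =>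
      G.Adj u w ∧ v ∈ (σ' w).sent).card := by
    intro u v hvu hadj
    rw [hrel.cnt_eq u v hadj]
    have h1 : ((afterInitial G u).prepare p (tie u) (.random 0)).cnt v = 0 := by
      refine (afterInitial_cnt G u v).trans ?_
      simp [hvu, hadj]
    rw [h1, zero_add]
    refine Finset.card_le_card fun w hw => ?_
    rw [Finset.mem_filter] at hw ⊢
    exact ⟨hw.1, hw.2.1, hw.2.2.1⟩
  have hlayer : ∀ u v, 1 ≤ cliqueDist u v → v ∈ (σ' u).sent → v.2 = u.2 := by
    intro u v huv hv
    rcases hsent_of u v hv with h1 | h1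
    · rw [h1]
    · rcases cliquePath_adj.1 h1 with h2 | h2
      · exact h2.2
      · omega
  have hcnt3 : ∀ u v, 1 ≤ cliqueDist u v → v.2 ≠ u.2 → (σ' u).cnt v ≤ 3 := by
    intro u v huv hne
    refine (hcnt_le u v (fun h => hne (by rw [h])) fun h => ?_).trans ?_
    · rcases cliquePath_adj.1 h with h2 | h2
      · exact hne h2.2
      · omega
    · refine card_adj_le_three (u := u) (v := v) _ fun w hw => ?_
      simp only [Finset.mem_filter, Finset.mem_univ, true_and] at hw
      refine ⟨hw.1, fun hd => (hlayer w v ?_ hw.2).symm⟩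
      unfold cliqueDist at *
      omega
  -- A message needs two matching hops to come from distance two, so it travels straight along a
  -- layer.
  have hfar : ∀ u v, v ∈ (σ' u).received → 2 ≤ cliqueDist u v → cliqueDist u v = 2 ∧
      v.2 = u.2 ∧ ∃ y, cliqueDist u y = 1 ∧ y.2 = u.2 ∧ cliqueDist y v = 1 ∧ v ∈ (σ' y).sent := by
    intro u v hv huv
    rcases hrec_of u v hv with h1 | h1 | ⟨w, h1, h2, h3⟩
    · rw [h1] at huv
      simp [cliqueDist] at huv
    · have := cliqueDist_le_one_of_adj h1
      omega
    · rcases cliquePath_adj.1 h1 with ⟨h4, h5⟩ | ⟨h4, h5⟩ <;>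
        rcases cliquePath_adj.1 h2 with ⟨h6, h7⟩ | ⟨h6, h7⟩
      · refine ⟨?_, h7.trans h5, w, h4, h5, h6, h3⟩
        unfold cliqueDist at *
        omega
      all_goals
        unfold cliqueDist at *
        omega
  have hknown : ∀ u v, cliqueDist u v = 0 → v ∈ (σ' u).received ∧ p.tau ≤ 2 * (σ' u).cnt v := by
    intro u v huv
    have hor : v = u ∨ G.Adj u v := by
      by_cases he : v.2 = u.2
      · exact .inl (eq_of_cliqueDist_eq_zero huv he.symm).symm
      · exact .inr (cliquePath_adj.2 (.inr ⟨huv, he⟩))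
    refine ⟨hrec_adj u v hor, ?_⟩
    have h1 := hcnt_ge u v
    rw [if_pos hor] at h1
    have h2 := hmany v
    set X := Finset.univ.filter fun x => cliqueDist v x = 0 ∧ x ≠ v ∧ v ∈ (σ' x).sent with hX
    have h3 : X.card - 1 ≤ (X.erase u).card := Finset.pred_card_le_card_erase
    have h4 : (X.erase u).card ≤ (Finset.univ.filter fun w =>
        G.Adj u w ∧ v ∈ (σ' w).sent ∧ v ≠ w).card := by
      refine Finset.card_le_card fun w hw => ?_
      simp only [hX, Finset.mem_erase, Finset.mem_filter, Finset.mem_univ, true_and] at hw ⊢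
      obtain ⟨hwu, hd, hne, hs⟩ := hw
      have hd' : cliqueDist u w = 0 := by
        unfold cliqueDist at *
        omega
      exact ⟨cliquePath_adj.2 (.inr ⟨hd', fun he =>
        hwu (eq_of_cliqueDist_eq_zero hd' he.symm).symm⟩), hs, hne.symm⟩
    omega
  have hoff : ∀ u v, v ∈ (σ' u).offered → v ∈ (σ' u).received := fun u v h =>
    (NodeState.mem_offered.1 h).1.1
  -- What `w` knows from the side of `y` is the message of its matching neighbour there, one of the
  -- at most `τ + 1` messages sent by that neighbour, or one of at most `5τ/2` messages passed on by
  -- clique members from their own matching neighbours. The sum is at most `4τ`.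
  have hbeyond : ∀ w y, cliqueDist w y = 1 → ∀ S : Finset (Fin (n / k) × Fin k),
      (∀ v ∈ S, v ∈ (σ' w).received ∧ cliqueDist w v = cliqueDist y v + 1) →
      S.card ≤ 4 * p.tau := by
    intro w y hwy S hS
    set E := Finset.univ.filter fun x => cliqueDist w x = 0 ∧ (y.1, x.2) ∈ (σ' x).sent with hE
    have hsub : S ⊆ insert (y.1, w.2) ((σ' (y.1, w.2)).sent) ∪
        E.image (fun x => (y.1, x.2)) := by
      intro v hv
      obtain ⟨hr, hd⟩ := hS v hv
      simp only [Finset.mem_union, Finset.mem_insert, Finset.mem_image]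
      rcases hrec_of w v hr with h1 | h1 | ⟨x, h1, h2, h3⟩
      · rw [h1] at hd
        simp [cliqueDist] at hd
      · rcases cliquePath_adj.1 h1 with ⟨h4, h5⟩ | ⟨h4, h5⟩
        · refine .inl (.inl (Prod.ext (Fin.ext ?_) h5))
          unfold cliqueDist at *
          simp only
          omega
        · omega
      · rcases cliquePath_adj.1 h1 with ⟨h4, h5⟩ | ⟨h4, h5⟩
        · have h6 := cliqueDist_le_one_of_adj h2
          have hx : x = (y.1, w.2) := by
            refine Prod.ext (Fin.ext ?_) h5
            unfold cliqueDist at *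
            simp only
            omega
          exact .inl (.inr (hx ▸ h3))
        · right
          rcases cliquePath_adj.1 h2 with ⟨h6, h7⟩ | ⟨h6, h7⟩
          · have hv : v = (y.1, x.2) := by
              refine Prod.ext (Fin.ext ?_) h7
              unfold cliqueDist at *
              simp only
              omega
            refine ⟨x, ?_, hv.symm⟩
            simp only [hE, Finset.mem_filter, Finset.mem_univ, true_and]
            exact ⟨h4, hv ▸ h3⟩
          · unfold cliqueDist at *
            omega
    have h1 := (Finset.card_le_card hsub).trans (Finset.card_union_le _ _)
    have h2 := Finset.card_insert_le (y.1, w.2) ((σ' (y.1, w.2)).sent)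
    have h3 := hcard (y.1, w.2)
    have h4 : (E.image (fun x => (y.1, x.2))).card ≤ E.card := Finset.card_image_le
    have h5 := hfew w y hwy
    rw [← hE] at h5
    omega
  -- Every far message that is at `u`, or may arrive there, is already known to the matching
  -- neighbour of `u` on that side, where `hbeyond` counts it.
  have htwo : ∀ u v, 2 ≤ cliqueDist u v →
      (v ∈ (σ' u).received ∨ ∃ w, G.Adj u w ∧ v ∈ (σ' w).offered) →
      ∃ w, cliqueDist u w = 1 ∧ w.2 = u.2 ∧ v ∈ (σ' w).received ∧
        cliqueDist u v = cliqueDist w v + 1 ∧ cliqueDist w v ≤ 2 := by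
    intro u v huv hv
    have hclose : ∀ u', cliqueDist u u' = 0 → v ∈ (σ' u').received →
        ∃ w, cliqueDist u w = 1 ∧ w.2 = u.2 ∧ v ∈ (σ' w).received ∧
          cliqueDist u v = cliqueDist w v + 1 ∧ cliqueDist w v ≤ 2 := by
      intro u' hu' hv
      have huv' : 2 ≤ cliqueDist u' v := by
        unfold cliqueDist at *
        omega
      obtain ⟨h1, h2, y, h3, h4, h5, h6⟩ := hfar u' v hv huv'
      refine ⟨(y.1, u.2), ?_, rfl, ?_, ?_, ?_⟩
      · unfold cliqueDist at *
        simp only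
        omega
      · by_cases he : u.2 = y.2
        · refine hrec_adj _ _ (.inr (cliquePath_adj.2 (.inl ⟨?_, ?_⟩)))
          · unfold cliqueDist at *
            simp only
            omega
          · rw [h2, ← h4, he]
        · refine hrec_new _ y v (cliquePath_adj.2 (.inr ⟨by simp [cliqueDist], ?_⟩)) h6 ?_
          · simpa using Ne.symm he
          · rintro rfl
            simp [cliqueDist] at h5
      · unfold cliqueDist at *
        simp only
        omega
      · unfold cliqueDist at *
        simp only
        omega
    rcases hv with hv | ⟨w, hw, hv⟩
    · exact hclose u (by simp [cliqueDist]) hv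
    · rcases cliquePath_adj.1 hw with ⟨h1, h2⟩ | ⟨h1, h2⟩
      · have h3 := hoff w v hv
        have h4 : cliqueDist w v ≤ 2 := by
          by_contra h4
          have := (hfar w v h3 (by omega)).1
          omega
        refine ⟨w, h1, h2, h3, ?_, h4⟩
        by_cases h5 : 2 ≤ cliqueDist w v
        · obtain ⟨h6, -, y, h7, h8, h9, -⟩ := hfar w v h3 h5
          unfold cliqueDist at *
          omega
        · unfold cliqueDist at *
          omega
      · exact hclose w h1 (hoff w v hv)
  refine ⟨?_, ?_, ?_, ?_, ?_, ?_, ?_⟩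
  · intro u v huv
    exact hknown u v (by omega)
  · intro u v huv
    exact hlayer u v (by omega)
  · intro u v huv
    refine hcnt_le u v (fun h => ?_) (fun h => ?_)
    · rw [h] at huv
      simp [cliqueDist] at huv
    · have := cliqueDist_le_one_of_adj h
      omega
  · intro u v hv
    by_cases h : cliqueDist u v ≤ 1
    · exact .inl h
    · have := hfar u v (hoff u v hv) (by omega)
      exact .inr ⟨rfl, this.1, this.2.1⟩
  · intro u v hv huv
    have := hfar u v hv (by omega)
    exact ⟨by omega, by omega, this.2.1⟩
  · intro u
    refine (card_le_of_sides _ u (4 * p.tau) fun v₀ hv₀ => ?_).trans (by omega)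
    simp only [Finset.mem_filter, Finset.mem_univ, true_and] at hv₀
    obtain ⟨w, hw1, hw2, hw3, hw4, hw5⟩ := htwo u v₀ (by omega) hv₀.2
    obtain ⟨y, hy1, hy2, hy3⟩ := exists_towards (r := cliqueDist w v₀ - 1) (u := w) (v := v₀)
      (by omega)
    refine hbeyond w y hy1 _ fun v hv => ?_
    simp only [Finset.mem_filter, Finset.mem_univ, true_and] at hv
    obtain ⟨w', h1, h2, h3, h4, h5⟩ := htwo u v (by omega) hv.1.2
    have hside := hv.2
    rw [Fin.lt_def, Fin.lt_def] at hside
    have hww : w' = w := by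
      refine eq_of_cliqueDist_eq_zero ?_ (h2.trans hw2.symm)
      unfold cliqueDist at *
      omega
    subst hww
    refine ⟨h3, ?_⟩
    unfold cliqueDist at *
    omega
  · intro u v huv
    have huv1 : cliqueDist u v = 1 := by omega
    refine le_trans (by have := hmany v; omega) (Nat.mul_le_mul_left 2
      (card_clique_le (u := v) (u' := u) (Finset.univ.filter fun x =>
      cliqueDist v x = 0 ∧ x ≠ v ∧ v ∈ (σ' x).sent) _ (fun x hx => ?_) fun x hx => ?_))
    · simp only [Finset.mem_filter, Finset.mem_univ, true_and] at hx
      exact hx.1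
    · simp only [Finset.mem_filter, Finset.mem_univ, true_and] at hx
      obtain ⟨hd, hne, hs⟩ := hx
      have hl : v.2 ≠ x.2 := fun he => hne (eq_of_cliqueDist_eq_zero hd he).symm
      have hdw : 1 ≤ cliqueDist (u.1, x.2) v := huv1.ge
      have hrec : v ∈ (σ' (u.1, x.2)).received := by
        refine hrec_new _ x v (cliquePath_adj.2 (.inl ⟨?_, rfl⟩)) hs hne.symm
        unfold cliqueDist at *
        simp only
        omega
      have hdef : (σ' (u.1, x.2)).deferred = ∅ := hrel.deferred_eq _
      have hsel : (σ' (u.1, x.2)).selected = ∅ := hrel.selected_eq _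
      have hc3 := hcnt3 (u.1, x.2) v hdw hl
      simp only [Finset.mem_filter, Finset.mem_univ, true_and]
      refine ⟨by simp [cliqueDist], ?_, fun tie' => ?_⟩
      · rw [NodeState.mem_offered, hdef]
        exact ⟨⟨hrec, fun h => hl (hlayer (u.1, x.2) v hdw h)⟩, Finset.notMem_empty _⟩
      · unfold NodeState.rank
        set w : Fin (n / k) × Fin k := (u.1, x.2)
        -- Preceding `v` requires `cnt ≤ 3`, which excludes the messages of the own clique. The
        -- others come from distance one or two, at most `4τ` from each side.
        have hmem : ∀ z ∈ (σ' w).offered.filter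
            (fun z => (σ' w).sortKey tie' z ≤ (σ' w).sortKey tie' v),
            z ∈ (σ' w).received ∧ 1 ≤ cliqueDist w z ∧ cliqueDist w z ≤ 2 := by
          intro z hz
          rw [Finset.mem_filter] at hz
          have hr := hoff w z hz.1
          have hle := NodeState.cnt_le_of_rank hsel hz.2
          refine ⟨hr, ?_, ?_⟩
          · by_contra h0
            have := (hknown w z (by omega)).2
            omega
          · by_contra h4
            have := (hfar w z hr (by omega)).1
            omega
        refine (card_le_of_sides _ w (4 * p.tau) fun z₀ hz₀ => ?_).trans (by omega)
        obtain ⟨-, hz1, hz2⟩ := hmem z₀ hz₀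
        obtain ⟨y, hy1, hy2, hy3⟩ := exists_towards (r := cliqueDist w z₀ - 1) (u := w) (v := z₀)
          (by omega)
        refine hbeyond w y hy1 _ fun z hz => ?_
        rw [Finset.mem_filter] at hz
        obtain ⟨h1, h2, h3⟩ := hmem z hz.1
        refine ⟨h1, ?_⟩
        have hside := hz.2
        rw [Fin.lt_def, Fin.lt_def] at hside
        unfold cliqueDist at *
        omega

end RandomPhase

/-! ### The ranking function -/

section Ranking

variable {V : Type*} [Fintype V] [DecidableEq V]

theorem NodeState.sortKey_injective (s : NodeState V) (tie : V ↪ ℕ) :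
    Function.Injective (s.sortKey tie) := by
  intro v w h
  unfold NodeState.sortKey at h
  split_ifs at h <;> simp [Prod.ext_iff] at h
  · exact h
  · exact h.2

theorem NodeState.rank_injOn (s : NodeState V) (tie : V ↪ ℕ) (B : Finset V) :
    Set.InjOn (s.rank tie B) B := by
  classical
  have key : ∀ v ∈ B, ∀ w ∈ B, s.sortKey tie v < s.sortKey tie w →
      s.rank tie B v < s.rank tie B w := by
    intro v _ w hw hlt
    refine Finset.card_lt_card ((Finset.ssubset_iff_of_subset fun x hx => ?_).2 ⟨w, ?_, ?_⟩)
    · rw [Finset.mem_filter] at hx ⊢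
      exact ⟨hx.1, hx.2.trans hlt.le⟩
    · exact Finset.mem_filter.2 ⟨hw, le_rfl⟩
    · rw [Finset.mem_filter, not_and, not_le]
      exact fun _ => hlt
  intro v hv w hw h
  by_contra hne
  rcases lt_or_gt_of_ne (fun he => hne (s.sortKey_injective tie he)) with h1 | h1
  · exact (key v hv w hw h1).ne h
  · exact (key w hw v hv h1).ne' h

theorem NodeState.rank_pos {s : NodeState V} {tie : V ↪ ℕ} {B : Finset V} {v : V} (hv : v ∈ B) :
    0 < s.rank tie B v := by
  classical
  exact Finset.card_pos.2 ⟨v, Finset.mem_filter.2 ⟨hv, le_rfl⟩⟩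

theorem NodeState.rank_le_card (s : NodeState V) (tie : V ↪ ℕ) (B : Finset V) (v : V) :
    s.rank tie B v ≤ B.card := Finset.card_filter_le _ _

/-- The ranks are distinct and lie between `1` and `b`, so the sum of their reciprocals is at most
`H_b`. -/
theorem NodeState.sum_rankingFunction_le (s : NodeState V) (tie : V ↪ ℕ) (B : Finset V) :
    ∑ v ∈ B, s.rankingFunction tie B v ≤ 1 := by
  classical
  have h1 : ∑ v ∈ B, 1 / (s.rank tie B v : ℝ≥0)
      ≤ ∑ j ∈ Finset.range B.card, 1 / ((j : ℝ≥0) + 1) := by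
    have hinj : Set.InjOn (fun v => s.rank tie B v - 1) B := by
      intro v hv w hw h
      have h2 := NodeState.rank_pos (s := s) (tie := tie) hv
      have h3 := NodeState.rank_pos (s := s) (tie := tie) hw
      simp only at h
      exact s.rank_injOn tie B hv hw (by omega)
    have h2 : ∑ v ∈ B, 1 / (s.rank tie B v : ℝ≥0)
        = ∑ j ∈ B.image (fun v => s.rank tie B v - 1), 1 / ((j : ℝ≥0) + 1) := by
      rw [Finset.sum_image hinj]
      refine Finset.sum_congr rfl fun v hv => ?_
      have h3 := NodeState.rank_pos (s := s) (tie := tie) hv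
      congr 1
      norm_cast
      omega
    rw [h2]
    refine Finset.sum_le_sum_of_subset fun j hj => ?_
    obtain ⟨v, hv, rfl⟩ := Finset.mem_image.1 hj
    have h3 := NodeState.rank_pos (s := s) (tie := tie) hv
    have h4 := s.rank_le_card tie B v
    rw [Finset.mem_range]
    omega
  unfold NodeState.rankingFunction
  simp_rw [one_div, mul_inv]
  rw [← Finset.sum_mul]
  simp_rw [one_div] at h1
  exact (mul_le_mul_left h1 _).trans mul_inv_le_one

theorem NodeState.le_rankingFunction {s : NodeState V} {tie : V ↪ ℕ} {B : Finset V} {v : V}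
    (hv : v ∈ B) {m : ℕ} (hr : s.rank tie B v ≤ m) {q : ℝ≥0}
    (hq : q * (m * ∑ j ∈ Finset.range (Fintype.card V), 1 / ((j : ℝ≥0) + 1)) ≤ 1) :
    q ≤ s.rankingFunction tie B v := by
  unfold NodeState.rankingFunction
  have hH : 0 < ∑ j ∈ Finset.range B.card, 1 / ((j : ℝ≥0) + 1) := by
    refine Finset.sum_pos (fun j _ => by positivity) ?_
    exact Finset.nonempty_range_iff.2 (Finset.card_ne_zero_of_mem hv)
  have h1 : (0 : ℝ≥0) < s.rank tie B v := by exact_mod_cast NodeState.rank_pos hv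
  rw [le_div_iff₀ (mul_pos h1 hH)]
  refine le_trans ?_ hq
  gcongr
  exact Finset.card_le_univ B

end Ranking

/-! ### The probability of a failure in a phase -/

/-- The factor is `1 - m/(2b)`, and `1 - x ≤ e^(-x)`. -/
theorem hitFactor_half_le {b m : ℕ} (hb : 0 < b) (hm : m ≤ b) {x : ℝ} (hx : x * (2 * b) ≤ m) :
    hitFactor (1 / 2) b m ≤ ENNReal.ofReal (Real.exp (-x)) := by
  have hb' : (0 : ℝ) < b := by exact_mod_cast hb
  have h1 : hitFactor (1 / 2) b m = ENNReal.ofReal (((b - m : ℕ) + 1 / 2 * m : ℝ) / b) := by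
    unfold hitFactor
    rw [ENNReal.ofReal_div_of_pos hb', ENNReal.ofReal_add (by positivity) (by positivity),
      ENNReal.ofReal_mul (by positivity), ENNReal.ofReal_natCast, ENNReal.ofReal_natCast,
      ENNReal.ofReal_natCast, ENNReal.ofReal_div_of_pos two_pos]
    simp
  rw [h1]
  refine ENNReal.ofReal_le_ofReal ?_
  refine le_trans ?_ (Real.add_one_le_exp (-x))
  rw [div_le_iff₀ hb', Nat.cast_sub hm]
  linarith

theorem hitFactor_two_le {b m : ℕ} (hb : 0 < b) (hm : m ≤ b) {x : ℝ} (hx : m ≤ x * b) :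
    hitFactor 2 b m ≤ ENNReal.ofReal (Real.exp x) := by
  have hb' : (0 : ℝ) < b := by exact_mod_cast hb
  have h1 : hitFactor 2 b m = ENNReal.ofReal (((b - m : ℕ) + 2 * m : ℝ) / b) := by
    unfold hitFactor
    rw [ENNReal.ofReal_div_of_pos hb', ENNReal.ofReal_add (by positivity) (by positivity),
      ENNReal.ofReal_mul (by positivity), ENNReal.ofReal_natCast, ENNReal.ofReal_natCast,
      ENNReal.ofReal_natCast]
    simp
  rw [h1]
  refine ENNReal.ofReal_le_ofReal ?_
  refine le_trans ?_ (Real.add_one_le_exp x)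
  rw [div_le_iff₀ hb', Nat.cast_sub hm]
  linarith

theorem prod_le_ofReal_exp {ι : Type*} (W : Finset ι) (f : ι → ℝ≥0∞) (x : ℝ)
    (h : ∀ i ∈ W, f i ≤ ENNReal.ofReal (Real.exp x)) :
    ∏ i ∈ W, f i ≤ ENNReal.ofReal (Real.exp (W.card * x)) := by
  refine (Finset.prod_le_prod' h).trans ?_
  rw [Finset.prod_const, ← ENNReal.ofReal_pow (Real.exp_pos x).le, ← Real.exp_nat_mul]

theorem prod_ite_one {ι : Type*} (W : Finset ι) (P : ι → Prop) [DecidablePred P] (z : ℝ≥0∞) :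
    (∏ i ∈ W, if P i then z else 1) = z ^ (W.filter P).card := by
  rw [Finset.prod_ite, Finset.prod_const, Finset.prod_const, one_pow, mul_one]

/-- Supplies the test function of Markov's inequality: a count in the role of `b` gives the lower
tail, in the role of `a` the upper tail. -/
theorem one_le_two_pow_mul_half_pow {a b : ℕ} (h : b ≤ a) : (1 : ℝ≥0∞) ≤ 2 ^ a * (1 / 2) ^ b := by
  calc (1 : ℝ≥0∞) = 2 ^ b * (1 / 2) ^ b := by
        rw [← mul_pow, one_div, ENNReal.mul_inv_cancel (by simp) (by simp), one_pow]
    _ ≤ _ := by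
      gcongr
      exact one_le_two

/-! ### Sizes of cliques and of distance spheres. -/

section CliqueCard

variable {N k : ℕ}

theorem card_clique (a : Fin N) :
    (Finset.univ.filter fun v : Fin N × Fin k => v.1 = a).card = k := by
  have h : (Finset.univ.filter fun v : Fin N × Fin k => v.1 = a)
      = Finset.univ.image fun j : Fin k => (a, j) := by
    ext v
    simp only [Finset.mem_filter, Finset.mem_univ, true_and, Finset.mem_image]
    exact ⟨fun hv => ⟨v.2, Prod.ext hv.symm rfl⟩, by rintro ⟨j, rfl⟩; rfl⟩
  rw [h, Finset.card_image_of_injective _ (fun i j hij => (Prod.mk.inj hij).2)]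
  simp

theorem card_cliqueDist_zero (u : Fin N × Fin k) :
    (Finset.univ.filter fun v => cliqueDist u v = 0).card = k := by
  refine Eq.trans ?_ (card_clique (k := k) u.1)
  congr 1
  ext v
  simp only [Finset.mem_filter, Finset.mem_univ, true_and]
  unfold cliqueDist
  refine ⟨fun h => Fin.ext (by omega), fun h => by rw [h]; omega⟩

theorem card_cliqueDist_le (u : Fin N × Fin k) (s : ℕ) :
    (Finset.univ.filter fun v => cliqueDist u v = s).card ≤ 2 * k := by
  refine card_le_of_sides _ u k fun v₀ hv₀ => ?_
  rw [Finset.mem_filter] at hv₀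
  refine (Finset.card_le_card fun v hv => ?_).trans (card_clique (k := k) v₀.1).le
  simp only [Finset.mem_filter, Finset.mem_univ, true_and, Fin.lt_def] at hv ⊢
  refine Fin.ext ?_
  unfold cliqueDist at *
  omega

theorem le_card_cliqueDist {u v : Fin N × Fin k} {s : ℕ} (h : cliqueDist u v = s) :
    k ≤ (Finset.univ.filter fun v => cliqueDist u v = s).card := by
  refine (card_clique (k := k) v.1).ge.trans (Finset.card_le_card fun w hw => ?_)
  simp only [Finset.mem_filter, Finset.mem_univ, true_and, Fin.ext_iff] at hw ⊢
  unfold cliqueDist at *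
  omega

theorem two_mul_le_card_cliqueDist {u v v' : Fin N × Fin k} {s : ℕ} (h : cliqueDist u v = s)
    (h' : cliqueDist u v' = s) (hne : v.1 ≠ v'.1) :
    2 * k ≤ (Finset.univ.filter fun v => cliqueDist u v = s).card := by
  have hsum : 2 * k = (Finset.univ.filter fun w : Fin N × Fin k => w.1 = v.1).card
      + (Finset.univ.filter fun w : Fin N × Fin k => w.1 = v'.1).card := by
    rw [card_clique, card_clique, two_mul]
  rw [hsum, ← Finset.card_union_of_disjoint]
  · refine Finset.card_le_card fun w hw => ?_
    simp only [Finset.mem_union, Finset.mem_filter, Finset.mem_univ, true_and, Fin.ext_iff] at hw ⊢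
    unfold cliqueDist at *
    omega
  · rw [Finset.disjoint_left]
    intro w hw hw'
    rw [Finset.mem_filter] at hw hw'
    exact hne (hw.2.symm.trans hw'.2)

end CliqueCard

section Phases

variable {n k : ℕ}

theorem card_nodes : Fintype.card (Fin (n / k) × Fin k) = n / k * k := by simp

/-- A ranking phase fails with small probability. -/
theorem failProb_ranking_phase {p : Params} {tie : TieRule (Fin (n / k) × Fin k)} {r : ℕ}
    {σ : Fin (n / k) × Fin k → NodeState _} (hτ : 6 < p.tau) (hτ' : 0 < p.tauRank)
    (h : RankingStart p r σ) {q : ℝ≥0}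
    (hq : q * ((8 * p.tau : ℕ) *
      ∑ j ∈ Finset.range (n / k * k), 1 / ((j : ℝ≥0) + 1)) ≤ 1) :
    failProb (run p (cliquePath n k) tie (p.rankingStart r) p.tauRank σ) (ShuffleStart p r)
      ≤ ((n / k * k : ℕ) : ℝ≥0∞) ^ 2 * (1 - (q : ℝ≥0∞)) ^ p.tauRank := by
  classical
  rw [run_ranking_phase hτ' (fun j hj => p.stage_ranking r hj)]
  set t := fun u => tie u (p.rankingStart r) (σ u)
  have hdisj : ∀ u v, v ∈ ((σ u).prepare p (t u) (.ranking 0)).buffer →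
      v ∉ ((σ u).prepare p (t u) (.ranking 0)).sent := by
    intro u v hv
    exact (NodeState.mem_offered.1 hv).1.2
  refine (failProb_mono fun σ' hσ' hgood => h.shuffleStart hτ t (popRel_of_popRun hdisj hσ')
    hgood).trans ((failProb_forall_pair_le
    (popRun (cliquePath n k) p.tauRank fun u => (σ u).prepare p (t u) (.ranking 0))
    (fun u v σ' => v ∈ (σ u).offered →
      (∀ tie, (σ u).rank tie (σ u).offered v ≤ 8 * p.tau) → v ∈ (σ' u).sent)
    ((1 - (q : ℝ≥0∞)) ^ p.tauRank) fun u v => ?_).trans_eq (by rw [card_nodes]))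
  by_cases hv : v ∈ (σ u).offered ∧ ∀ tie, (σ u).rank tie (σ u).offered v ≤ 8 * p.tau
  · refine (failProb_le_expect (f := fun σ' => if v ∈ (σ' u).buffer then 1 else 0)
      fun σ' hσ' hbad => ?_).trans ((expect_mem_buffer_popRun_le (cliquePath n k) p.tauRank _
        (q := q) ?_ ?_).trans ?_)
    · rw [if_pos]
      by_contra hb
      exact hbad fun h2 _ => (popRel_of_popRun hdisj hσ').sent_of_buffer u v h2 hb
    · refine NodeState.le_rankingFunction hv.1 (hv.2 (t u)) ?_
      rw [card_nodes]
      exact hq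
    · exact (σ u).sum_rankingFunction_le _ _
    · split_ifs
      · exact le_rfl
      · exact zero_le
  · refine (failProb_eq_zero fun σ' h2 h3 => ?_).trans_le zero_le
    exact absurd ⟨h2, h3⟩ hv

/-- A shuffle phase fails with small probability. -/
theorem failProb_shuffle_phase {p : Params} {tie : TieRule (Fin (n / k) × Fin k)} {r : ℕ}
    {σ : Fin (n / k) × Fin k → NodeState _} (hτ : 6 < p.tau) (hc : p.cHat ≤ 1 / 2)
    (hc' : 4 < p.cHat * p.threshold) (hk : 4 * p.tau ≤ k) (h : ShuffleStart p r σ) :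
    failProb (run p (cliquePath n k) tie (p.rankingStart r + p.tauRank) (8 * p.tau) σ)
        (RankingStart p (r + 1))
      ≤ ((n / k * k : ℕ) : ℝ≥0∞) ^ 2 *
          (2 ^ ((p.tau + 5) / 2) * ENNReal.ofReal (Real.exp (-p.tau)))
        + ((n / k * k : ℕ) : ℝ≥0∞) ^ 2 * (1 / 2) ^ (4 * p.tau) := by
  classical
  obtain ⟨σ', hrel, hrun⟩ := run_shuffle_phase (G := cliquePath n k) (tie := tie) (p := p)
    (by omega) (fun j hj => p.stage_shuffle r hj) σ
  have hcand := h.candidates_eq hτ hc hc' hrel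
  have hkpos : (0 : ℝ) < k := by
    have : 0 < k := by omega
    exact_mod_cast this
  rw [hrun]
  set μ := independent fun u => (σ' u).selectionLaw p with hμ
  have hmap : ∀ Q, failProb (μ.map fun A u => (σ' u).finishShuffle p (A u)) Q
      = failProb μ fun A => Q fun u => (σ' u).finishShuffle p (A u) := fun Q => expect_map _ _ _
  rw [hmap]
  refine (failProb_mono (Q := fun A =>
    (∀ u v, cliqueDist u v = r + 2 →
      p.tau + 6 ≤ 2 * (Finset.univ.filter fun w => cliqueDist u w = 0 ∧ v ∈ A w).card) ∧
    (∀ u v, cliqueDist u v = r + 2 → (∃ v', cliqueDist u v' = r + 2 ∧ v.1 ≠ v'.1) →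
        ¬ A u ⊆ Finset.univ.filter fun w => w.1 = v.1)) fun A hA hgood => ?_).trans
    ((failProb_and_le _ _ _).trans (add_le_add
      ((failProb_forall_pair_le _ _ _ fun u v => ?_).trans_eq (by rw [card_nodes]))
      ((failProb_forall_pair_le _ _ _ fun u v => ?_).trans_eq (by rw [card_nodes]))))
  · have hsel := fun u => mem_support_selectionLaw (mem_support_of_independent hA u)
    refine h.rankingStart hτ hrel hcand A (fun u => (hsel u).1)
      (fun u => (hsel u).2.le.trans (min_le_left _ _)) hgood.1 ?_
    intro u v v' hv hv' hne hall
    refine hgood.2 u v hv ⟨v', hv', hne⟩ fun w hw => ?_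
    exact Finset.mem_filter.2 ⟨Finset.mem_univ _, hall w hw⟩
  · by_cases hd : cliqueDist u v = r + 2
    · set W := Finset.univ.filter fun w => cliqueDist u w = 0 with hW
      refine (failProb_le_expect (f := fun A => 2 ^ ((p.tau + 5) / 2) *
        ∏ w ∈ W, if v ∈ A w then 1 / 2 else 1) fun A _ hbad => ?_).trans ?_
      · rw [prod_ite_one, hW, Finset.filter_filter]
        refine one_le_two_pow_mul_half_pow ?_
        by_contra hlt
        exact hbad fun _ => by omega
      · rw [expect_const_mul]
        gcongr
        rw [hμ, expect_independent_prod_mem _ W fun w A => if v ∈ A then 1 / 2 else 1]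
        -- At most `2k` candidates and `4τ` selections give the factor `1 - 4τ/(2·2k)` at worst.
        refine (prod_le_ofReal_exp W _ (-(p.tau / k)) fun w hw => ?_).trans ?_
        · have hdw : cliqueDist w v = r + 2 := by
            rw [hW, Finset.mem_filter] at hw
            unfold cliqueDist at *
            omega
          have hlow : k ≤ ((σ' w).candidates p).card := by
            rw [hcand]
            exact le_card_cliqueDist hdw
          have hup : ((σ' w).candidates p).card ≤ 2 * k := by
            rw [hcand]
            exact card_cliqueDist_le w _
          rw [expect_selectionLaw_mem (by rw [hcand]; simpa using hdw) (by omega)]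
          refine hitFactor_half_le (by omega) (by omega) ?_
          have hup' : (((σ' w).candidates p).card : ℝ) ≤ 2 * k := by exact_mod_cast hup
          calc (p.tau : ℝ) / k * (2 * ((σ' w).candidates p).card)
              ≤ (p.tau : ℝ) / k * (2 * (2 * k)) := by gcongr
            _ = _ := by
              push_cast
              field_simp
              ring
        · rw [hW, card_cliqueDist_zero]
          refine ENNReal.ofReal_le_ofReal (Real.exp_le_exp.2 (le_of_eq ?_))
          field_simp
    · exact (failProb_eq_zero fun A h2 => absurd h2 hd).trans_le zero_le
  · by_cases hd : cliqueDist u v = r + 2 ∧ ∃ v', cliqueDist u v' = r + 2 ∧ v.1 ≠ v'.1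
    · obtain ⟨hd, v', hd', hne⟩ := hd
      refine (failProb_le_expect (f := fun A =>
        if A u ⊆ Finset.univ.filter (fun w => w.1 = v.1) then 1 else 0)
        fun A _ hbad => ?_).trans ?_
      · rw [if_pos]
        by_contra hb
        exact hbad fun _ _ => hb
      · rw [hμ, expect_independent_apply (fun u => (σ' u).selectionLaw p) u
          (fun A => if A ⊆ Finset.univ.filter (fun w => w.1 = v.1) then 1 else 0)]
        -- The candidates fill two whole cliques, so one clique is at most half of them.
        have h2k : 2 * k ≤ ((σ' u).candidates p).card := by
          rw [hcand]
          exact two_mul_le_card_cliqueDist hd hd' hne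
        refine expect_selectionLaw_subset_le (by omega) ?_
        rw [card_clique]
        exact h2k
    · exact (failProb_eq_zero fun A h2 h3 => absurd ⟨h2, h3⟩ hd).trans_le zero_le

end Phases

/-! ### The random phase, and the union bound over all phases. -/

section Phases

variable {n k : ℕ}

theorem card_afterInitial_unsent (x : Fin (n / k) × Fin k) :
    k - 1 ≤ (afterInitial (cliquePath n k) x).unsent.card ∧
      (afterInitial (cliquePath n k) x).unsent.card ≤ k + 3 := by
  classical
  set Z := Finset.univ.filter fun v => cliqueDist x v = 0 with hZ
  have hcard : Z.card = k := card_cliqueDist_zero x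
  constructor
  · refine le_trans (b := (Z.erase x).card) ?_ (Finset.card_le_card fun v hv => ?_)
    · have h1 : Z.card - 1 ≤ (Z.erase x).card := Finset.pred_card_le_card_erase
      omega
    · simp only [hZ, Finset.mem_erase, Finset.mem_filter, Finset.mem_univ, true_and] at hv
      rw [afterInitial_unsent, cliquePath_adj]
      exact .inr ⟨hv.2, fun he => hv.1 (eq_of_cliqueDist_eq_zero hv.2 he.symm).symm⟩
  · have hsub : (afterInitial (cliquePath n k) x).unsent ⊆
        Z ∪ Finset.univ.filter fun v => cliqueDist x v = 1 ∧ v.2 = x.2 := by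
      intro v hv
      rw [afterInitial_unsent, cliquePath_adj] at hv
      simp only [hZ, Finset.mem_union, Finset.mem_filter, Finset.mem_univ, true_and]
      rcases hv with hv | hv
      · exact .inr hv
      · exact .inl hv.1
    refine (Finset.card_le_card hsub).trans ((Finset.card_union_le _ _).trans ?_)
    rw [hcard]
    refine Nat.add_le_add_left (card_le_three x x.2 _ fun w hw => ?_) _
    rw [Finset.mem_filter] at hw
    exact .inr hw.2

/-- The random phase fails with small probability. -/
theorem failProb_random_phase {p : Params} {tie : TieRule (Fin (n / k) × Fin k)}
    (hτ : 6 < p.tau) (hk : p.tau + 1 ≤ k) :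
    failProb (execution p (cliquePath n k) tie (p.rankingStart 0)) (RankingStart p 0)
      ≤ ((n / k * k : ℕ) : ℝ≥0∞) * (2 ^ ((p.tau + 5) / 2) *
          ENNReal.ofReal (Real.exp (((k - 1 : ℕ) : ℝ) * -(p.tau / (2 * (k + 3))))))
        + ((n / k * k : ℕ) : ℝ≥0∞) ^ 2 * ((1 / 2) ^ (5 * p.tau / 2) *
          ENNReal.ofReal (Real.exp (k * (p.tau / (k - 1 : ℕ))))) := by
  classical
  have hstart : p.rankingStart 0 = 1 + p.tau := by simp [Params.rankingStart]
  rw [hstart, execution_add, execution_one, PMF.pure_bind,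
    run_random_phase (by omega) (fun j hj => p.stage_random hj)]
  set t := fun u => tie u 1 (afterInitial (cliquePath n k) u)
  set σ := fun u => (afterInitial (cliquePath n k) u).prepare p (t u) (.random 0) with hσ
  have hbuf : ∀ u v, v ∈ (σ u).buffer ↔ (cliquePath n k).Adj u v := fun u v =>
    afterInitial_unsent _
  have hsent : ∀ u, (σ u).sent = {u} := fun u => rfl
  have hcard : ∀ u, k - 1 ≤ (σ u).buffer.card ∧ (σ u).buffer.card ≤ k + 3 := fun u =>
    card_afterInitial_unsent u
  have hdisj : ∀ u v, v ∈ (σ u).buffer → v ∉ (σ u).sent := by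
    intro u v hv
    rw [hbuf] at hv
    rw [hsent, Finset.mem_singleton]
    exact hv.ne'
  have hprob : ∀ u, ∃ a : ℝ≥0, a ≠ 0 ∧ ∀ v, (σ u).prob v = a := by
    intro u
    refine ⟨1 / ((afterInitial (cliquePath n k) u).unsent.card : ℝ≥0), ?_, fun v => rfl⟩
    have h1 := (card_afterInitial_unsent u).1
    have h2 : (afterInitial (cliquePath n k) u).unsent.card ≠ 0 := by omega
    exact one_div_ne_zero (by exact_mod_cast h2)
  have hmain : ∀ (W : Finset (Fin (n / k) × Fin k)) (f : _ → _) (z : ℝ≥0∞),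
      (∀ x ∈ W, (cliquePath n k).Adj x (f x)) →
      expect (popRun (cliquePath n k) p.tau σ)
        (fun σ' => ∏ x ∈ W, if f x ∈ (σ' x).sent then z else 1)
        ≤ ∏ x ∈ W, hitFactor z (σ x).buffer.card p.tau := by
    intro W f z hW
    refine (expect_prod_popRun (cliquePath n k) W f z p.tau σ (fun x _ => hprob x)
      (fun x _ => ?_) fun x hx => .inr ((hbuf x _).2 (hW x hx))).trans_eq
      (Finset.prod_congr rfl fun x hx => if_neg ?_)
    · have := (hcard x).1
      omega
    · exact hdisj x _ ((hbuf x _).2 (hW x hx))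
  refine (failProb_mono (Q := fun σ' => (∀ v, p.tau + 6 ≤ 2 * (Finset.univ.filter fun x =>
      cliqueDist v x = 0 ∧ x ≠ v ∧ v ∈ (σ' x).sent).card) ∧
      ∀ u y, cliqueDist u y = 1 → 2 * (Finset.univ.filter fun x =>
        cliqueDist u x = 0 ∧ (y.1, x.2) ∈ (σ' x).sent).card ≤ 5 * p.tau)
    fun σ' hσ' hgood => rankingStart_zero hτ t (popRel_of_popRun hdisj hσ') (fun u => ?_)
      hgood.1 hgood.2).trans
    ((failProb_and_le _ _ _).trans (add_le_add
      ((failProb_forall_le _ _ _ fun v => ?_).trans_eq (by rw [card_nodes]))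
      ((failProb_forall_pair_le _ _ _ fun u y => ?_).trans_eq (by rw [card_nodes]))))
  · have h1 := card_sent_le_of_popRun hσ' u
    rw [hsent, Finset.card_singleton] at h1
    omega
  -- Lower tail. The node `v` itself is left out, having sent its message in round `0`.
  · set W := (Finset.univ.filter fun x => cliqueDist v x = 0).erase v with hW
    have hWc : W.card = k - 1 := by
      rw [hW, Finset.card_erase_of_mem (by simp [cliqueDist]), card_cliqueDist_zero]
    have hWm : ∀ x ∈ W, x ≠ v ∧ cliqueDist v x = 0 := by
      intro x hx
      simpa [hW] using hx
    refine (failProb_le_expect (f := fun σ' => 2 ^ ((p.tau + 5) / 2) *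
      ∏ x ∈ W, if v ∈ (σ' x).sent then 1 / 2 else 1) fun σ' _ hbad => ?_).trans ?_
    · rw [prod_ite_one]
      refine one_le_two_pow_mul_half_pow ?_
      have hle : (W.filter fun x => v ∈ (σ' x).sent).card ≤ (Finset.univ.filter fun x =>
          cliqueDist v x = 0 ∧ x ≠ v ∧ v ∈ (σ' x).sent).card := by
        refine Finset.card_le_card fun x hx => ?_
        rw [Finset.mem_filter] at hx
        have := hWm x hx.1
        exact Finset.mem_filter.2 ⟨Finset.mem_univ _, this.2, this.1, hx.2⟩
      by_contra hlt
      exact hbad (by omega)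
    · rw [expect_const_mul]
      gcongr
      refine (hmain W (fun _ => v) (1 / 2) fun x hx => ?_).trans ?_
      · obtain ⟨h1, h2⟩ := hWm x hx
        rw [cliqueDist_comm] at h2
        exact cliquePath_adj.2 (.inr ⟨h2, fun he => h1 (eq_of_cliqueDist_eq_zero h2 he.symm)⟩)
      · refine (prod_le_ofReal_exp W _ (-(p.tau / (2 * (k + 3)))) fun x hx => ?_).trans_eq
          (by rw [hWc])
        obtain ⟨h1, h2⟩ := hcard x
        refine hitFactor_half_le (by omega) (by omega) ?_
        have h3 : ((σ x).buffer.card : ℝ) ≤ k + 3 := by exact_mod_cast h2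
        rw [div_mul_eq_mul_div, div_le_iff₀ (by positivity)]
        gcongr
  · by_cases huy : cliqueDist u y = 1
    -- Upper tail at `5τ/2`; each node pops the message of its matching neighbour with probability
    -- at most `τ/(k - 1)`.
    · set W := Finset.univ.filter fun x => cliqueDist u x = 0 with hW
      have hWc : W.card = k := card_cliqueDist_zero u
      refine (failProb_le_expect (f := fun σ' => (1 / 2) ^ (5 * p.tau / 2) *
        ∏ x ∈ W, if (y.1, x.2) ∈ (σ' x).sent then 2 else 1) fun σ' _ hbad => ?_).trans ?_
      · rw [prod_ite_one, hW, Finset.filter_filter, mul_comm]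
        refine one_le_two_pow_mul_half_pow ?_
        by_contra hlt
        exact hbad fun _ => by omega
      · rw [expect_const_mul]
        gcongr
        refine (hmain W (fun x => (y.1, x.2)) 2 fun x hx => ?_).trans ?_
        · rw [hW, Finset.mem_filter] at hx
          refine cliquePath_adj.2 (.inl ⟨?_, rfl⟩)
          unfold cliqueDist at *
          simp only
          omega
        · refine (prod_le_ofReal_exp W _ (p.tau / (k - 1 : ℕ)) fun x hx => ?_).trans_eq
            (by rw [hWc])
          obtain ⟨h1, h2⟩ := hcard x
          refine hitFactor_two_le (by omega) (by omega) ?_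
          have h3 : (0 : ℝ) < (k - 1 : ℕ) := by
            have : 0 < k - 1 := by omega
            exact_mod_cast this
          have h4 : ((k - 1 : ℕ) : ℝ) ≤ (σ x).buffer.card := by exact_mod_cast h1
          rw [div_mul_eq_mul_div, le_div_iff₀ h3]
          gcongr
    · exact (failProb_eq_zero fun σ' h2 => absurd h2 huy).trans_le zero_le

/-- All distances on the path are less than `n / k`, so no shuffle phase is needed at the end. -/
theorem ShuffleStart.complete {p : Params} {r : ℕ} {σ : Fin (n / k) × Fin k → NodeState _}
    (h : ShuffleStart p r σ) (hr : n / k ≤ r + 1) : Complete σ := by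
  intro u v
  refine (h.known u v ?_).1
  have h1 := u.1.isLt
  have h2 := v.1.isLt
  unfold cliqueDist
  omega

/-- The phases fail with small probability. -/
theorem failProb_phases {p : Params} {tie : TieRule (Fin (n / k) × Fin k)} {ε₀ ε : ℝ≥0∞}
    (h₀ : failProb (execution p (cliquePath n k) tie (p.rankingStart 0)) (RankingStart p 0) ≤ ε₀)
    {ε₁ ε₂ : ℝ≥0∞} (hε : ε₁ + ε₂ ≤ ε)
    (h₁ : ∀ r σ, RankingStart p r σ →
      failProb (run p (cliquePath n k) tie (p.rankingStart r) p.tauRank σ) (ShuffleStart p r) ≤ ε₁)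
    (h₂ : ∀ r σ, ShuffleStart p r σ →
      failProb (run p (cliquePath n k) tie (p.rankingStart r + p.tauRank) (8 * p.tau) σ)
        (RankingStart p (r + 1)) ≤ ε₂) (r : ℕ) :
    failProb (execution p (cliquePath n k) tie (p.rankingStart r + p.tauRank)) (ShuffleStart p r)
      ≤ ε₀ + (r + 1) * ε := by
  have hrank : ∀ r, failProb (execution p (cliquePath n k) tie (p.rankingStart r))
      (RankingStart p r) ≤ ε₀ + r * ε := by
    intro r
    induction r with
    | zero => simpa using h₀
    | succ r ih =>
      rw [Params.rankingStart_succ, execution_add, execution_add]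
      refine (failProb_bind_le fun σ _ hσ => h₂ r σ hσ).trans ?_
      refine (add_le_add_left (failProb_bind_le fun σ _ hσ => h₁ r σ hσ) _).trans ?_
      calc _ ≤ ε₀ + r * ε + ε₁ + ε₂ := by gcongr
        _ = ε₀ + r * ε + (ε₁ + ε₂) := by ring
        _ ≤ ε₀ + r * ε + ε := by gcongr
        _ = _ := by
          push_cast
          ring
  rw [execution_add]
  refine (failProb_bind_le fun σ _ hσ => h₁ r σ hσ).trans ?_
  calc _ ≤ ε₀ + r * ε + ε := by
        gcongr
        · exact hrank r
        · exact le_self_add.trans hε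
    _ = _ := by ring

/-- The probability of incompleteness after `n / k` ranking phases. -/
theorem failProb_complete_le {p : Params} {tie : TieRule (Fin (n / k) × Fin k)} {q : ℝ≥0}
    {δ : ℝ≥0∞} (hn : 0 < n / k) (hτ : 6 < p.tau) (hτ' : 0 < p.tauRank) (hk : 4 * p.tau ≤ k)
    (hc : p.cHat ≤ 1 / 2) (hc' : 4 < p.cHat * p.threshold)
    (hq : q * ((8 * p.tau : ℕ) *
      ∑ j ∈ Finset.range (n / k * k), 1 / ((j : ℝ≥0) + 1)) ≤ 1)
    (h₁ : 2 ^ ((p.tau + 5) / 2) *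
      ENNReal.ofReal (Real.exp (((k - 1 : ℕ) : ℝ) * -(p.tau / (2 * (k + 3))))) ≤ δ)
    (h₂ : (1 / 2) ^ (5 * p.tau / 2) *
      ENNReal.ofReal (Real.exp (k * (p.tau / (k - 1 : ℕ)))) ≤ δ)
    (h₃ : 2 ^ ((p.tau + 5) / 2) * ENNReal.ofReal (Real.exp (-p.tau)) ≤ δ)
    (h₄ : (1 / 2) ^ (4 * p.tau) ≤ δ) (h₅ : (1 - (q : ℝ≥0∞)) ^ p.tauRank ≤ δ) :
    failProb (execution p (cliquePath n k) tie (p.rankingStart (n / k - 1) + p.tauRank)) Complete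
      ≤ 5 * ((n / k * k : ℕ) : ℝ≥0∞) ^ 3 * δ := by
  set M := n / k * k with hM
  have hkpos : 0 < k := by omega
  have hM1 : 1 ≤ (M : ℝ≥0∞) := by
    have : 1 ≤ M := Nat.mul_pos hn hkpos
    exact_mod_cast this
  have hNM : ((n / k - 1 : ℕ) : ℝ≥0∞) + 1 ≤ M := by
    have h1 : n / k - 1 + 1 ≤ M := by
      rw [Nat.sub_add_cancel hn]
      exact Nat.le_mul_of_pos_right _ hkpos
    exact_mod_cast h1
  have key := failProb_phases (p := p) (tie := tie)
    (failProb_random_phase hτ (by omega)) (ε := 3 * (M : ℝ≥0∞) ^ 2 * δ)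
    (ε₁ := (M : ℝ≥0∞) ^ 2 * δ) (ε₂ := (M : ℝ≥0∞) ^ 2 * δ + (M : ℝ≥0∞) ^ 2 * δ) (le_of_eq (by ring))
    (fun r σ hσ => (failProb_ranking_phase hτ hτ' hσ hq).trans (by gcongr))
    (fun r σ hσ => (failProb_shuffle_phase hτ hc hc' hk hσ).trans (by gcongr)) (n / k - 1)
  refine (failProb_mono fun σ _ hσ => hσ.complete (by omega)).trans (key.trans ?_)
  calc _ ≤ (M : ℝ≥0∞) * δ + (M : ℝ≥0∞) ^ 2 * δ + M * (3 * (M : ℝ≥0∞) ^ 2 * δ) := by gcongr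
    _ ≤ (M : ℝ≥0∞) ^ 3 * δ + (M : ℝ≥0∞) ^ 3 * δ + M * (3 * (M : ℝ≥0∞) ^ 2 * δ) := by
      gcongr ?_ * δ + ?_ * δ + _
      · exact le_self_pow hM1 (by norm_num)
      · exact pow_le_pow_right₀ hM1 (by norm_num)
    _ = _ := by ring

end Phases

/-! ### Numerical estimates -/

theorem two_pow_eq_ofReal_exp (m : ℕ) :
    (2 : ℝ≥0∞) ^ m = ENNReal.ofReal (Real.exp (m * Real.log 2)) := by
  rw [Real.exp_nat_mul, Real.exp_log two_pos, ENNReal.ofReal_pow two_pos.le, ENNReal.ofReal_ofNat]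

theorem half_pow_eq_ofReal_exp (m : ℕ) :
    (1 / 2 : ℝ≥0∞) ^ m = ENNReal.ofReal (Real.exp (-(m * Real.log 2))) := by
  rw [Real.exp_neg, ENNReal.ofReal_inv_of_pos (Real.exp_pos _), ← two_pow_eq_ofReal_exp, one_div,
    ENNReal.inv_pow]

/-- Works because `(log 2)/2 < 0.35` is below `0.49 - 0.1` and `(5/2) log 2 < 2`. -/
theorem two_pow_mul_exp_le (t : ℕ) {y : ℝ} (hy : y ≤ -(0.49 * t)) :
    2 ^ ((t + 5) / 2) * ENNReal.ofReal (Real.exp y)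
      ≤ ENNReal.ofReal (Real.exp (2 - 0.1 * t)) := by
  rw [two_pow_eq_ofReal_exp, ← ENNReal.ofReal_mul (Real.exp_pos _).le, ← Real.exp_add]
  refine ENNReal.ofReal_le_ofReal (Real.exp_le_exp.2 ?_)
  have h1 : (((t + 5) / 2 : ℕ) : ℝ) ≤ (t + 5) / 2 := by
    have := @Nat.cast_div_le ℝ _ _ _ (t + 5) 2
    simpa using this
  have h2 := Real.log_two_lt_d9
  have h3 : (((t + 5) / 2 : ℕ) : ℝ) * Real.log 2 ≤ (t + 5) / 2 * 0.6931471808 :=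
    mul_le_mul h1 h2.le (Real.log_nonneg one_le_two) (by positivity)
  have h4 : (0 : ℝ) ≤ t := Nat.cast_nonneg t
  linarith

/-- Works because `(5/2) log 2 > 1.7` exceeds `1.01 + 0.1`. -/
theorem half_pow_mul_exp_le (t : ℕ) {y : ℝ} (hy : y ≤ 1.01 * t) :
    (1 / 2) ^ (5 * t / 2) * ENNReal.ofReal (Real.exp y)
      ≤ ENNReal.ofReal (Real.exp (2 - 0.1 * t)) := by
  rw [half_pow_eq_ofReal_exp, ← ENNReal.ofReal_mul (Real.exp_pos _).le, ← Real.exp_add]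
  refine ENNReal.ofReal_le_ofReal (Real.exp_le_exp.2 ?_)
  have h1 : (5 * t - 1) / 2 ≤ ((5 * t / 2 : ℕ) : ℝ) := by
    have h : 5 * t ≤ 2 * (5 * t / 2) + 1 := by omega
    have h' : (5 * t : ℝ) ≤ 2 * ((5 * t / 2 : ℕ) : ℝ) + 1 := by exact_mod_cast h
    linarith
  have h2 := Real.log_two_gt_d9
  have h3 : ((5 * t / 2 : ℕ) : ℝ) * 0.6931471803 ≤ ((5 * t / 2 : ℕ) : ℝ) * Real.log 2 := by
    gcongr
  have h4 : (0 : ℝ) ≤ t := Nat.cast_nonneg t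
  linarith

theorem half_pow_four_mul_le (t : ℕ) :
    (1 / 2 : ℝ≥0∞) ^ (4 * t) ≤ ENNReal.ofReal (Real.exp (2 - 0.1 * t)) := by
  rw [half_pow_eq_ofReal_exp]
  refine ENNReal.ofReal_le_ofReal (Real.exp_le_exp.2 ?_)
  have h2 := Real.log_two_gt_d9
  have h4 : (0 : ℝ) ≤ t := Nat.cast_nonneg t
  have h3 : ((4 * t : ℕ) : ℝ) * 0.6931471803 ≤ ((4 * t : ℕ) : ℝ) * Real.log 2 := by
    gcongr
  push_cast at h3 ⊢
  linarith

theorem one_sub_pow_le (q : ℝ≥0) (m : ℕ) :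
    (1 - (q : ℝ≥0∞)) ^ m ≤ ENNReal.ofReal (Real.exp (-(m * q))) := by
  have h1 : (1 - (q : ℝ≥0∞)) ≤ ENNReal.ofReal (Real.exp (-q)) := by
    have h2 : (1 - (q : ℝ≥0∞)) = ENNReal.ofReal (1 - (q : ℝ)) := by
      rw [ENNReal.ofReal_sub 1 q.coe_nonneg, ENNReal.ofReal_one, ENNReal.ofReal_coe_nnreal]
    rw [h2]
    refine ENNReal.ofReal_le_ofReal ?_
    linarith [Real.add_one_le_exp (-(q : ℝ))]
  refine (pow_le_pow_left' h1 m).trans_eq ?_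
  rw [← ENNReal.ofReal_pow (Real.exp_pos _).le, ← Real.exp_nat_mul]
  congr 2
  ring

theorem sum_one_div_le (n : ℕ) :
    ((∑ j ∈ Finset.range n, 1 / ((j : ℝ≥0) + 1) : ℝ≥0) : ℝ) ≤ 1 + Real.log n := by
  refine le_trans (le_of_eq ?_) (harmonic_le_one_add_log n)
  unfold harmonic
  push_cast
  simp [one_div]

/-- The surplus of base two over base `e` absorbs the `1` in `H_n ≤ 1 + log n`, and lets `d > c + 3`
suffice for the exponent `c + 4`. -/
theorem log_le_logb {n : ℕ} (hn : 1 ≤ n) : 1.4 * Real.log n ≤ Real.logb 2 n := by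
  have h1 : 0 ≤ Real.log n := Real.log_nonneg (by exact_mod_cast hn)
  have h2 := Real.log_two_lt_d9
  unfold Real.logb
  rw [le_div_iff₀ (Real.log_pos one_lt_two)]
  nlinarith

/-- After `n / k` ranking phases the execution is incomplete with probability at most `1 / n ^ c`,
if `n` and `k` are large enough. -/
theorem failProb_complete_params_le {c α d cHat : ℝ} (hc : 1 ≤ c) (hα : 48 * c + 96 < α)
    (hd : c + 3 < d) (hcHat : cHat ≤ 1 / 2) {n k : ℕ} (hn : 40 ≤ n) (hkn : k ∣ n)
    (hl : 4 ≤ Real.logb 2 n) (hcHat' : 8 < cHat * (α * Real.logb 2 n))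
    (hk : (8 * α + 400) * Real.logb 2 n ≤ k) (tie : TieRule (Fin (n / k) × Fin k)) :
    failProb (execution (params α d cHat n) (cliquePath n k) tie
      ((params α d cHat n).rankingStart (n / k - 1) + (params α d cHat n).tauRank)) Complete
        ≤ ENNReal.ofReal (1 / (n : ℝ) ^ c) := by
  set p := params α d cHat n with hp
  set l := Real.logb 2 n with hldef
  have hα0 : 0 < α := by linarith
  have hd0 : 0 < d := by linarith
  have hl0 : 0 < l := by linarith
  have hn0 : (0 : ℝ) < n := by
    have : 0 < n := by omega
    exact_mod_cast this
  have hτl : α * l ≤ p.tau := Nat.le_ceil _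
  have hτu : (p.tau : ℝ) ≤ 2 * (α * l) := by
    have h1 : (p.tau : ℝ) < α * l + 1 := Nat.ceil_lt_add_one (by positivity)
    nlinarith
  have hτ' : 8 * d * p.tau * l ^ 2 ≤ p.tauRank := Nat.le_ceil _
  have hαl : 144 * 4 ≤ α * l := by nlinarith
  have hτ6 : 6 < p.tau := by
    have : (6 : ℝ) < p.tau := by linarith
    exact_mod_cast this
  have hτ0 : (0 : ℝ) < p.tau := by linarith
  have hτR : 0 < p.tauRank := by
    have : (0 : ℝ) < p.tauRank := lt_of_lt_of_le (by positivity) hτ'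
    exact_mod_cast this
  have hk4 : 4 * p.tau ≤ k := by
    have : 4 * (p.tau : ℝ) ≤ k := by nlinarith
    exact_mod_cast this
  have hk400 : 400 ≤ k := by
    have : (400 : ℝ) ≤ k := by nlinarith
    exact_mod_cast this
  have hkR : (400 : ℝ) ≤ k := by exact_mod_cast hk400
  have hk1 : ((k - 1 : ℕ) : ℝ) = k - 1 := by
    rw [Nat.cast_sub (by omega)]
    simp
  have hM : n / k * k = n := Nat.div_mul_cancel hkn
  have hN : 0 < n / k := Nat.div_pos (Nat.le_of_dvd (by omega) hkn) (by omega)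
  have hlog := log_le_logb (n := n) (by omega)
  rw [← hldef] at hlog
  have hlog0 : 0 ≤ Real.log n := Real.log_nonneg (by
    have : 1 ≤ n := by omega
    exact_mod_cast this)
  -- The `8` bounds `e^2`. Against the `5 n^3` of the union bound, the power `n^(-(c+4))` leaves
  -- `n^(-c)` times `40/n`, whence `40 ≤ n`.
  set δ : ℝ := 8 * Real.exp (-((c + 4) * Real.log n)) with hδ
  have hexp : ENNReal.ofReal (Real.exp (2 - 0.1 * p.tau)) ≤ ENNReal.ofReal δ := by
    refine ENNReal.ofReal_le_ofReal ?_
    have h1 : Real.exp 2 ≤ 8 := by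
      have h2 := Real.exp_one_lt_d9
      have h3 : Real.exp 2 = Real.exp 1 * Real.exp 1 := by
        rw [← Real.exp_add]
        norm_num
      rw [h3]
      nlinarith [Real.exp_pos 1]
    rw [sub_eq_add_neg, Real.exp_add, hδ]
    refine mul_le_mul h1 (Real.exp_le_exp.2 (neg_le_neg ?_)) (Real.exp_pos _).le (by norm_num)
    have h3 : (48 * c + 96) * l ≤ α * l := by gcongr
    have h4 : (c + 4) * Real.log n ≤ (c + 4) * l := by
      gcongr
      linarith
    nlinarith
  -- `8τ` bounds the rank and `l` bounds the harmonic number.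
  set q : ℝ≥0 := ⟨1 / (8 * p.tau * l), by positivity⟩ with hqdef
  have hqR : (q : ℝ) = 1 / (8 * p.tau * l) := rfl
  have hfail := failProb_complete_le (p := p) (tie := tie) (q := q) (δ := ENNReal.ofReal δ)
    hN hτ6 hτR hk4 hcHat ?_ ?_ ?_ ?_ ?_ ?_ ?_
  · refine hfail.trans ?_
    rw [hM]
    have h1 : 5 * (n : ℝ≥0∞) ^ 3 * ENNReal.ofReal δ = ENNReal.ofReal (5 * (n : ℝ) ^ 3 * δ) := by
      rw [ENNReal.ofReal_mul (p := 5 * (n : ℝ) ^ 3) (by positivity),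
        ENNReal.ofReal_mul (p := 5) (by norm_num), ENNReal.ofReal_pow hn0.le, ENNReal.ofReal_natCast, ENNReal.ofReal_ofNat]
    rw [h1]
    refine ENNReal.ofReal_le_ofReal ?_
    have h2 : Real.exp (-((c + 4) * Real.log n)) = 1 / ((n : ℝ) ^ c * (n : ℝ) ^ 4) := by
      rw [Real.exp_neg, ← one_div, ← Real.rpow_natCast, ← Real.rpow_add hn0,
        Real.rpow_def_of_pos hn0]
      norm_num [mul_comm]
    have h3 : (0 : ℝ) < (n : ℝ) ^ c := Real.rpow_pos_of_pos hn0 c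
    have h4 : (40 : ℝ) ≤ n := by exact_mod_cast hn
    rw [hδ, h2]
    calc 5 * (n : ℝ) ^ 3 * (8 * (1 / ((n : ℝ) ^ c * (n : ℝ) ^ 4)))
        = 1 / (n : ℝ) ^ c * (40 / n) := by
          field_simp
          ring
      _ ≤ 1 / (n : ℝ) ^ c * 1 := by
        gcongr
        rw [div_le_one hn0]
        exact h4
      _ = _ := mul_one _
  · show 4 < cHat * ((p.tau : ℝ) / 2)
    have hcpos : 0 < cHat := by
      by_contra hneg
      have : cHat * (α * l) ≤ 0 := mul_nonpos_of_nonpos_of_nonneg (by linarith) (by positivity)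
      linarith
    have : cHat * (α * l) ≤ cHat * p.tau := by gcongr
    linarith
  · rw [hM, ← NNReal.coe_le_coe, NNReal.coe_mul, NNReal.coe_mul, hqR]
    have h1 := sum_one_div_le n
    have h2 : 1 + Real.log n ≤ l := by linarith
    have h3 : (((8 * p.tau : ℕ) : ℝ≥0) : ℝ) = 8 * p.tau := by
      push_cast
      rfl
    rw [h3, NNReal.coe_one, div_mul_eq_mul_div, one_mul, div_le_one (by positivity)]
    gcongr
    linarith
  · refine (two_pow_mul_exp_le p.tau ?_).trans hexp
    rw [hk1, mul_neg, neg_le_neg_iff, mul_div_assoc', le_div_iff₀ (by positivity)]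
    nlinarith
  · refine (half_pow_mul_exp_le p.tau ?_).trans hexp
    rw [hk1, mul_div_assoc', div_le_iff₀ (by linarith)]
    nlinarith
  · refine (two_pow_mul_exp_le p.tau ?_).trans hexp
    linarith
  · exact (half_pow_four_mul_le p.tau).trans hexp
  · refine (one_sub_pow_le q p.tauRank).trans (ENNReal.ofReal_le_ofReal ?_)
    rw [hδ]
    refine le_trans (Real.exp_le_exp.2 (neg_le_neg ?_)) (le_mul_of_one_le_left (Real.exp_pos _).le
      (by norm_num : (1 : ℝ) ≤ 8))
    rw [hqR]
    have h1 : d * l ≤ p.tauRank * (1 / (8 * p.tau * l)) := by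
      rw [mul_one_div, le_div_iff₀ (by positivity)]
      calc d * l * (8 * p.tau * l) = 8 * d * p.tau * l ^ 2 := by ring
        _ ≤ _ := hτ'
    refine le_trans ?_ h1
    -- Enough since `1.4 (c + 3) ≥ c + 4`.
    have h2 : d * (1.4 * Real.log n) ≤ d * l := by gcongr
    nlinarith

end InfoSpreading

end

/-! ### The main theorem: choice of the constant and the round count. -/

theorem mainTheorem3 (c : ℝ) (hc : 1 ≤ c) (α d : ℝ) (hα : 48 * c + 96 < α) (hd : c + 3 < d) :
    ∃ C : ℝ, 0 < C ∧
      ∀ cHat : ℝ, 0 < cHat → cHat ≤ 1 / 2 →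
      ∀ k : ℕ → ℕ, Filter.Tendsto (fun n : ℕ => (k n : ℝ) / Real.logb 2 n ^ 3)
          Filter.atTop Filter.atTop →
      ∀ᶠ n : ℕ in Filter.atTop, k n ∣ n →
      ∀ tie : InfoSpreading.TieRule (Fin (n / k n) × Fin (k n)),
        ENNReal.ofReal (1 - 1 / (n : ℝ) ^ c) ≤
          InfoSpreading.probComplete (InfoSpreading.params α d cHat n)
            (InfoSpreading.cliquePath n (k n)) tie
            ⌊C * (n * Real.logb 2 n ^ 3 / k n)⌋₊ := by
  have hα0 : 0 < α := by linarith
  have hd0 : 0 < d := by linarith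
  -- With `τ ≤ 2α log n`, a ranking and a shuffle phase together take at most `(16dα + 16α + 1) log³
  -- n` rounds. The remaining `2α + 1` pays for the random phase and round `0`.
  refine ⟨16 * d * α + 18 * α + 2, by positivity, fun cHat hcpos hcHat k hk => ?_⟩
  have hlogb : Tendsto (fun n : ℕ => Real.logb 2 (n : ℝ)) atTop atTop :=
    (Real.tendsto_logb_atTop one_lt_two).comp tendsto_natCast_atTop_atTop
  filter_upwards [eventually_ge_atTop 40, hlogb.eventually_ge_atTop 4,
    -- The first bound yields `ĉT > 4`; the second yields `4τ ≤ k` and brings `k/(k - 1)` and `(k -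
    -- 1)/(k + 3)` close enough to `1`.
    hlogb.eventually_gt_atTop (8 / (cHat * α)), hk.eventually_ge_atTop (8 * α + 400)]
    with n hn hl hlc hkl hkn tie
  set l := Real.logb 2 (n : ℝ) with hldef
  have hl0 : 0 < l := by linarith
  have hl3 : l ≤ l ^ 3 := by nlinarith [mul_pos hl0 hl0]
  rw [le_div_iff₀ (by positivity)] at hkl
  have hkl' : (8 * α + 400) * l ≤ k n := le_trans (by gcongr) hkl
  have hcl : 8 < cHat * (α * l) := by
    rw [div_lt_iff₀ (by positivity)] at hlc
    linarith
  have hfail := InfoSpreading.failProb_complete_params_le hc hα hd hcHat hn hkn hl hcl hkl' tie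
  set p := InfoSpreading.params α d cHat n with hp
  have hkpos : (0 : ℝ) < k n := lt_of_lt_of_le (by positivity) hkl'
  have hN : 1 ≤ n / k n := Nat.div_pos (Nat.le_of_dvd (by omega) hkn) (by exact_mod_cast hkpos)
  have hNR : (1 : ℝ) ≤ (n / k n : ℕ) := by exact_mod_cast hN
  have htime : p.rankingStart (n / k n - 1) + p.tauRank
      ≤ ⌊(16 * d * α + 18 * α + 2) * (n * l ^ 3 / k n)⌋₊ := by
    refine Nat.le_floor ?_
    have h1 : p.rankingStart (n / k n - 1) + p.tauRank
        ≤ 1 + p.tau + n / k n * (p.tauRank + 8 * p.tau) := by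
      obtain ⟨m, hm⟩ : ∃ m, n / k n = m + 1 := ⟨n / k n - 1, by omega⟩
      rw [hm, InfoSpreading.Params.rankingStart, Nat.add_sub_cancel, add_mul]
      omega
    have h2 : ((p.rankingStart (n / k n - 1) + p.tauRank : ℕ) : ℝ)
        ≤ 1 + p.tau + (n / k n : ℕ) * (p.tauRank + 8 * p.tau) := by exact_mod_cast h1
    refine h2.trans ?_
    have hdiv : ((n / k n : ℕ) : ℝ) = n / k n := Nat.cast_div hkn hkpos.ne'
    have hτu : (p.tau : ℝ) ≤ 2 * (α * l) := by
      have h3 : (p.tau : ℝ) < α * l + 1 := Nat.ceil_lt_add_one (by positivity)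
      nlinarith
    have hτRu : (p.tauRank : ℝ) ≤ 8 * d * (2 * (α * l)) * l ^ 2 + 1 := by
      have h3 : (p.tauRank : ℝ) < 8 * d * p.tau * l ^ 2 + 1 := Nat.ceil_lt_add_one (by positivity)
      have h4 : 8 * d * p.tau * l ^ 2 ≤ 8 * d * (2 * (α * l)) * l ^ 2 := by gcongr
      linarith
    rw [show (n : ℝ) * l ^ 3 / k n = (n / k n : ℕ) * l ^ 3 by rw [hdiv]; ring]
    have h5 : (1 : ℝ) ≤ l ^ 3 := by linarith
    have h6 : (p.tau : ℝ) ≤ 2 * α * l ^ 3 := by nlinarith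
    have h7 : (p.tauRank : ℝ) + 8 * p.tau ≤ (16 * d * α + 16 * α + 1) * l ^ 3 := by
      have : 8 * d * (2 * (α * l)) * l ^ 2 = 16 * d * α * l ^ 3 := by ring
      nlinarith
    calc 1 + (p.tau : ℝ) + (n / k n : ℕ) * (p.tauRank + 8 * p.tau)
        ≤ (n / k n : ℕ) * ((1 + 2 * α) * l ^ 3)
          + (n / k n : ℕ) * ((16 * d * α + 16 * α + 1) * l ^ 3) := by
          gcongr
          have h8 : (1 + 2 * α) * l ^ 3 ≤ (n / k n : ℕ) * ((1 + 2 * α) * l ^ 3) :=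
            le_mul_of_one_le_left (by positivity) hNR
          linarith
      _ = _ := by ring
  -- The `m` surplus rounds are harmless, as completeness is never lost.
  obtain ⟨m, hm⟩ := Nat.exists_eq_add_of_le htime
  rw [hm]
  calc ENNReal.ofReal (1 - 1 / (n : ℝ) ^ c)
      = 1 - ENNReal.ofReal (1 / (n : ℝ) ^ c) := by
        rw [ENNReal.ofReal_sub _ (by positivity), ENNReal.ofReal_one]
    _ ≤ 1 - InfoSpreading.failProb (InfoSpreading.execution p (InfoSpreading.cliquePath n (k n)) tie
        (p.rankingStart (n / k n - 1) + p.tauRank + m)) InfoSpreading.Complete :=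
      tsub_le_tsub_left ((InfoSpreading.failProb_complete_mono _ _ _ _ _).trans hfail) 1
    _ ≤ _ := InfoSpreading.one_sub_le_toOuterMeasure _ _
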